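/- Let $k$ be a field and let $Q$ be a finite quiver (finitely many vertices and arrows, multiple arrows allowed) without loops or oriented cycles. Let $B=kQ$ be its path algebra, with the convention that $\beta\alpha$ denotes the path "first $\alpha$, then $\beta$". For a vertex $i$, let $e_i$ be the trivial path at $i$, and let $S(i)$ and $T(i)$ be the simple left and the simple right $B$-module at $i$, that is, the one-dimensional module on which $e_i$ acts as the identity and every other path acts as $0$. An extension $B\subset A$ of finite dimensional $k$-algebras is called *bounded* if (1) $(A/B)^{\otimes_B p}=0$ for some $p\ge 1$; (2) $A/B$ has finite projective dimension as a $B$-$B$-bimodule, i.e. as a module over $B\otimes_k B^{\mathrm{op}}$; and (3) $\mathrm{Tor}_i^B(A/B,(A/B)^{\otimes_B j})=0$ for all $i,j\ge 1$. Here $M^{\otimes_B 0}=B$ and $M^{\otimes_B (j+1)}=M\otimes_B M^{\otimes_B j}$. **Proposition.** Let $u\neq v$ be vertices of $Q$ such that at least one arrow starts at $u$, at least one arrow ends at $v$, and there is no path in $Q$ from $u$ to $v$. Let $M:=S(u)\otimes_k T(v)$, a $B$-$B$-bimodule, and let $A:=B\ltimes M$ be the trivial extension of $B$ by $M$. Then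 $B\subset A$ is a bounded extension, and $M$ is projective neither as a left $B$-module nor as a right $B$-module. -/

import Mathlib

open scoped TensorProduct MulOpposite

universe u v w

noncomputable section

/-! ## Tensor products over a noncommutative ring

Right `R`-modules are modules over `Rᵐᵒᵖ`. -/

section Balanced

variable (R : Type*) [Ring R] (M : Type*) [AddCommGroup M] [Module Rᵐᵒᵖ M]
  (N : Type*) [AddCommGroup N] [Module R N]

/-- The relations `m r ⊗ n = m ⊗ r n`. -/
def balancedRel : AddSubgroup (M ⊗[ℤ] N) :=
  AddSubgroup.closure {t | ∃ (m : M) (r : R) (n : N),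
    t = (MulOpposite.op r • m) ⊗ₜ[ℤ] n - m ⊗ₜ[ℤ] (r • n)}

/-- The tensor product `M ⊗_R N` of a right `R`-module `M` and a left `R`-module `N`. -/
def BalancedTensor : Type _ := (M ⊗[ℤ] N) ⧸ balancedRel R M N

namespace BalancedTensor

instance : AddCommGroup (BalancedTensor R M N) :=
  inferInstanceAs (AddCommGroup ((M ⊗[ℤ] N) ⧸ balancedRel R M N))

/-- The projection `M ⊗_ℤ N → M ⊗_R N`. -/
def proj : M ⊗[ℤ] N →+ BalancedTensor R M N := QuotientAddGroup.mk' (balancedRel R M N)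

variable {M N}

/-- The pure tensor `m ⊗ n` in `M ⊗_R N`. -/
def tmul (m : M) (n : N) : BalancedTensor R M N := proj R M N (m ⊗ₜ[ℤ] n)

variable {M' : Type*} [AddCommGroup M'] [Module Rᵐᵒᵖ M']
  {N' : Type*} [AddCommGroup N'] [Module R N']

/-- The map `f ⊗ g : M ⊗_R N → M' ⊗_R N'`. -/
def map (f : M →ₗ[Rᵐᵒᵖ] M') (g : N →ₗ[R] N') :
    BalancedTensor R M N →+ BalancedTensor R M' N' :=
  QuotientAddGroup.map (balancedRel R M N) (balancedRel R M' N')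
    (TensorProduct.map f.toAddMonoidHom.toIntLinearMap
      g.toAddMonoidHom.toIntLinearMap).toAddMonoidHom (by
      rw [balancedRel, AddSubgroup.closure_le]
      rintro _ ⟨m, r, n, rfl⟩
      refine AddSubgroup.subset_closure ⟨f m, r, g n, ?_⟩
      rw [map_sub]
      change f (MulOpposite.op r • m) ⊗ₜ[ℤ] g n - f m ⊗ₜ[ℤ] g (r • n) = _
      rw [map_smul, map_smul])

@[simp]
theorem map_tmul (f : M →ₗ[Rᵐᵒᵖ] M') (g : N →ₗ[R] N') (m : M) (n : N) :
    map R f g (tmul R m n) = tmul R (f m) (g n) := rfl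

variable {R}

theorem hom_ext {G : Type*} [AddCommGroup G] {f g : BalancedTensor R M N →+ G}
    (h : ∀ m n, f (tmul R m n) = g (tmul R m n)) : f = g := by
  ext x
  obtain ⟨t, rfl⟩ := QuotientAddGroup.mk'_surjective (balancedRel R M N) x
  change f (proj R M N t) = g (proj R M N t)
  induction t using TensorProduct.induction_on with
  | zero => simp only [map_zero]
  | tmul m n => exact h m n
  | add s t hs ht => simp only [map_add, hs, ht]

theorem tmul_add (m : M) (n n' : N) : tmul R m (n + n') = tmul R m n + tmul R m n' := by
  simp only [tmul, TensorProduct.tmul_add, map_add]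

theorem add_tmul (m m' : M) (n : N) : tmul R (m + m') n = tmul R m n + tmul R m' n := by
  simp only [tmul, TensorProduct.add_tmul, map_add]

theorem zero_tmul (n : N) : tmul R (0 : M) n = 0 := by
  simp only [tmul, TensorProduct.zero_tmul, map_zero]

theorem tmul_zero (m : M) : tmul R m (0 : N) = 0 := by
  simp only [tmul, TensorProduct.tmul_zero, map_zero]

theorem smul_tmul (m : M) (r : R) (n : N) :
    tmul R (MulOpposite.op r • m) n = tmul R m (r • n) :=
  QuotientAddGroup.eq_iff_sub_mem.2 (AddSubgroup.subset_closure ⟨m, r, n, rfl⟩)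

variable (R M N) in
/-- The operators `s (m ⊗ n) = s m ⊗ n` on `M ⊗_R N`, for an action of a ring `S` on `M` commuting
with the right action of `R`. -/
def leftEnd (S : Type*) [Ring S] [Module S M] [SMulCommClass S Rᵐᵒᵖ M] :
    S →+* AddMonoid.End (BalancedTensor R M N) where
  toFun s := map R (Module.toModuleEnd Rᵐᵒᵖ M s) LinearMap.id
  map_one' := hom_ext fun m n => by
    change tmul R ((1 : S) • m) n = tmul R m n
    rw [one_smul]
  map_mul' s t := hom_ext fun m n => by
    change tmul R ((s * t) • m) n = tmul R (s • t • m) n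
    rw [mul_smul]
  map_zero' := hom_ext fun m n => by
    change tmul R ((0 : S) • m) n = 0
    rw [zero_smul, zero_tmul]
  map_add' s t := hom_ext fun m n => by
    change tmul R ((s + t) • m) n = tmul R (s • m) n + tmul R (t • m) n
    rw [add_smul, add_tmul]

variable (R M N) in
/-- The operators `s (m ⊗ n) = m ⊗ s n` on `M ⊗_R N`, for an action of a ring `S` on `N` commuting
with the left action of `R`. -/
def rightEnd (S : Type*) [Ring S] [Module S N] [SMulCommClass S R N] :
    S →+* AddMonoid.End (BalancedTensor R M N) where
  toFun s := map R LinearMap.id (Module.toModuleEnd R N s)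
  map_one' := hom_ext fun m n => by
    change tmul R m ((1 : S) • n) = tmul R m n
    rw [one_smul]
  map_mul' s t := hom_ext fun m n => by
    change tmul R m ((s * t) • n) = tmul R m (s • t • n)
    rw [mul_smul]
  map_zero' := hom_ext fun m n => by
    change tmul R m ((0 : S) • n) = 0
    rw [zero_smul, tmul_zero]
  map_add' s t := hom_ext fun m n => by
    change tmul R m ((s + t) • n) = tmul R m (s • n) + tmul R m (t • n)
    rw [add_smul, tmul_add]

end BalancedTensor

end Balanced

/-! ## Tor over a noncommutative ring -/

open CategoryTheory

/-- The functor `M ⊗_R -` from left `R`-modules to abelian groups, for a right `R`-module `M`. -/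
def tensorFunctor (R : Type v) [Ring R] (M : Type v) [AddCommGroup M] [Module Rᵐᵒᵖ M] :
    ModuleCat.{v} R ⥤ AddCommGrpCat.{v} where
  obj N := AddCommGrpCat.of (BalancedTensor R M N)
  map f := AddCommGrpCat.ofHom (BalancedTensor.map R LinearMap.id f.hom)
  map_id _ := by
    ext1
    exact BalancedTensor.hom_ext fun m n => by simp
  map_comp _ _ := by
    ext1
    exact BalancedTensor.hom_ext fun m n => by simp

instance (R : Type v) [Ring R] (M : Type v) [AddCommGroup M] [Module Rᵐᵒᵖ M] :
    (tensorFunctor R M).Additive where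
  map_add := by
    intros
    ext1
    exact BalancedTensor.hom_ext fun m n => BalancedTensor.tmul_add m _ _

/-- `Tor_i^R(M, N)`: the `i`-th left derived functor of `M ⊗_R -`, evaluated at `N`. -/
def torGroup (R : Type v) [Ring R] (M : Type v) [AddCommGroup M] [Module Rᵐᵒᵖ M]
    (N : Type v) [AddCommGroup N] [Module R N] (i : ℕ) : AddCommGrpCat.{v} :=
  ((tensorFunctor R M).leftDerived i).obj (ModuleCat.of R N)

/-! ## Bimodules -/

/-- A `B`-`B`-bimodule on which the field `k` acts centrally. -/
structure BimoduleOver (k : Type u) [Field k] (B : Type v) [Ring B] [Algebra k B] where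
  carrier : Type v
  [addCommGroup : AddCommGroup carrier]
  [moduleBase : Module k carrier]
  [moduleLeft : Module B carrier]
  [moduleRight : Module Bᵐᵒᵖ carrier]
  [towerLeft : IsScalarTower k B carrier]
  [towerRight : IsScalarTower k Bᵐᵒᵖ carrier]
  [smulComm : SMulCommClass B Bᵐᵒᵖ carrier]

namespace BimoduleOver

attribute [instance] addCommGroup moduleBase moduleLeft moduleRight towerLeft towerRight smulComm

variable {k : Type u} [Field k] {B : Type v} [Ring B] [Algebra k B]

/-- `B` as a bimodule over itself. -/
def regular (k : Type u) [Field k] (B : Type v) [Ring B] [Algebra k B] : BimoduleOver k B where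
  carrier := B

/-- The bimodule `M ⊗_B N`, with `b (m ⊗ n) b' = b m ⊗ n b'`. -/
def tensor (M N : BimoduleOver k B) : BimoduleOver k B :=
  letI : SMulCommClass Bᵐᵒᵖ B N.carrier := SMulCommClass.symm _ _ _
  letI : Module k (BalancedTensor B M.carrier N.carrier) :=
    Module.compHom _ (BalancedTensor.leftEnd B M.carrier N.carrier k)
  letI : Module B (BalancedTensor B M.carrier N.carrier) :=
    Module.compHom _ (BalancedTensor.leftEnd B M.carrier N.carrier B)
  letI : Module Bᵐᵒᵖ (BalancedTensor B M.carrier N.carrier) :=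
    Module.compHom _ (BalancedTensor.rightEnd B M.carrier N.carrier Bᵐᵒᵖ)
  { carrier := BalancedTensor B M.carrier N.carrier
    towerLeft := ⟨fun c b x => DFunLike.congr_fun
      (f := BalancedTensor.leftEnd B M.carrier N.carrier B (c • b))
      (g := BalancedTensor.leftEnd B M.carrier N.carrier k c *
        BalancedTensor.leftEnd B M.carrier N.carrier B b)
      (BalancedTensor.hom_ext fun m n => by
        change BalancedTensor.tmul B ((c • b) • m) n = BalancedTensor.tmul B (c • b • m) n
        rw [smul_assoc]) x⟩
    towerRight := ⟨fun c b x => DFunLike.congr_fun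
      (f := BalancedTensor.rightEnd B M.carrier N.carrier Bᵐᵒᵖ (c • b))
      (g := BalancedTensor.leftEnd B M.carrier N.carrier k c *
        BalancedTensor.rightEnd B M.carrier N.carrier Bᵐᵒᵖ b)
      (BalancedTensor.hom_ext fun m n => by
        change BalancedTensor.tmul B m ((c • b) • n) = BalancedTensor.tmul B (c • m) (b • n)
        rw [smul_assoc, ← algebraMap_smul B c (b • n), ← BalancedTensor.smul_tmul,
          ← MulOpposite.algebraMap_apply, algebraMap_smul]) x⟩
    smulComm := ⟨fun b b' x => DFunLike.congr_fun
      (f := BalancedTensor.leftEnd B M.carrier N.carrier B b *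
        BalancedTensor.rightEnd B M.carrier N.carrier Bᵐᵒᵖ b')
      (g := BalancedTensor.rightEnd B M.carrier N.carrier Bᵐᵒᵖ b' *
        BalancedTensor.leftEnd B M.carrier N.carrier B b)
      (BalancedTensor.hom_ext fun _ _ => rfl) x⟩ }

/-- The tensor powers `M^{⊗_B 0} = B` and `M^{⊗_B (i+1)} = M ⊗_B M^{⊗_B i}`. -/
def tensorPow (M : BimoduleOver k B) : ℕ → BimoduleOver k B
  | 0 => regular k B
  | i + 1 => M.tensor (M.tensorPow i)

/-- The bimodule `M` as a left module over the enveloping algebra `B ⊗_k Bᵐᵒᵖ`, where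
`(b ⊗ b') m = b m b'`. -/
def envelopingModule (M : BimoduleOver k B) : ModuleCat.{v} (B ⊗[k] Bᵐᵒᵖ) :=
  letI : Module (B ⊗[k] Bᵐᵒᵖ) M.carrier := TensorProduct.Algebra.module
  ModuleCat.of (B ⊗[k] Bᵐᵒᵖ) M.carrier

end BimoduleOver

/-! ## Bounded extensions -/

section Extension

variable {k : Type u} [Field k] {B A : Type v} [Ring B] [Algebra k B] [Ring A] [Algebra k A]

/-- The quotient `A / B` for an algebra homomorphism `f : B → A`, i.e. `A / f(B)`. -/
def ExtensionQuotient (f : B →ₐ[k] A) : Type v := A ⧸ LinearMap.range f.toLinearMap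

namespace ExtensionQuotient

variable (f : B →ₐ[k] A)

instance : AddCommGroup (ExtensionQuotient f) :=
  inferInstanceAs (AddCommGroup (A ⧸ LinearMap.range f.toLinearMap))

instance : Module k (ExtensionQuotient f) :=
  inferInstanceAs (Module k (A ⧸ LinearMap.range f.toLinearMap))

/-- The class of `a` in `A / B`. -/
def mk : A →ₗ[k] ExtensionQuotient f := (LinearMap.range f.toLinearMap).mkQ

theorem mk_surjective : Function.Surjective (mk f) := Submodule.mkQ_surjective _

/-- Left multiplication by `b` on `A / B`. -/
def leftMul (b : B) : ExtensionQuotient f →ₗ[k] ExtensionQuotient f :=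
  (LinearMap.range f.toLinearMap).mapQ (LinearMap.range f.toLinearMap) (LinearMap.mulLeft k (f b))
    (by rintro _ ⟨c, rfl⟩; exact ⟨b * c, by simp⟩)

/-- Right multiplication by `b` on `A / B`. -/
def rightMul (b : B) : ExtensionQuotient f →ₗ[k] ExtensionQuotient f :=
  (LinearMap.range f.toLinearMap).mapQ (LinearMap.range f.toLinearMap) (LinearMap.mulRight k (f b))
    (by rintro _ ⟨c, rfl⟩; exact ⟨c * b, by simp⟩)

instance : SMul B (ExtensionQuotient f) := ⟨fun b => leftMul f b⟩

instance : SMul Bᵐᵒᵖ (ExtensionQuotient f) := ⟨fun b => rightMul f b.unop⟩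

theorem smul_mk (b : B) (a : A) : b • mk f a = mk f (f b * a) := rfl

theorem op_smul_mk (b : Bᵐᵒᵖ) (a : A) : b • mk f a = mk f (a * f b.unop) := rfl

instance : Module B (ExtensionQuotient f) :=
  Module.ofMinimalAxioms (fun b x y => map_add (leftMul f b) x y)
    (fun b c x => by
      obtain ⟨a, rfl⟩ := mk_surjective f x
      simp only [smul_mk, map_add, add_mul])
    (fun b c x => by
      obtain ⟨a, rfl⟩ := mk_surjective f x
      simp only [smul_mk, map_mul, mul_assoc])
    (fun x => by
      obtain ⟨a, rfl⟩ := mk_surjective f x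
      simp only [smul_mk, map_one, one_mul])

instance : Module Bᵐᵒᵖ (ExtensionQuotient f) :=
  Module.ofMinimalAxioms (fun b x y => map_add (rightMul f b.unop) x y)
    (fun b c x => by
      obtain ⟨a, rfl⟩ := mk_surjective f x
      simp only [op_smul_mk, MulOpposite.unop_add, map_add, mul_add])
    (fun b c x => by
      obtain ⟨a, rfl⟩ := mk_surjective f x
      simp only [op_smul_mk, MulOpposite.unop_mul, map_mul, mul_assoc])
    (fun x => by
      obtain ⟨a, rfl⟩ := mk_surjective f x
      simp only [op_smul_mk, MulOpposite.unop_one, map_one, mul_one])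

instance : IsScalarTower k B (ExtensionQuotient f) := ⟨fun c b x => by
  obtain ⟨a, rfl⟩ := mk_surjective f x
  simp only [smul_mk, map_smul, smul_mul_assoc]⟩

instance : IsScalarTower k Bᵐᵒᵖ (ExtensionQuotient f) := ⟨fun c b x => by
  obtain ⟨a, rfl⟩ := mk_surjective f x
  simp only [op_smul_mk, MulOpposite.unop_smul, map_smul, mul_smul_comm]⟩

instance : SMulCommClass B Bᵐᵒᵖ (ExtensionQuotient f) := ⟨fun b c x => by
  obtain ⟨a, rfl⟩ := mk_surjective f x
  simp only [smul_mk, op_smul_mk, mul_assoc]⟩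

/-- `A / B` as a `B`-`B`-bimodule. -/
def bimodule : BimoduleOver k B where
  carrier := ExtensionQuotient f

end ExtensionQuotient

/-- The inclusion `f : B → A` of finite dimensional `k`-algebras is a bounded extension. -/
structure IsBoundedExtension (f : B →ₐ[k] A) : Prop where
  finite_sub : Module.Finite k B
  finite_ext : Module.Finite k A
  injective : Function.Injective f
  /-- `A / B` is `B`-tensor nilpotent. -/
  nilpotent : ∃ p : ℕ, 1 ≤ p ∧
    Subsingleton ((ExtensionQuotient.bimodule f).tensorPow p).carrier
  /-- `A / B` has finite projective dimension as a `B`-`B`-bimodule. -/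
  finite_projDim : ∃ n : ℕ,
    HasProjectiveDimensionLE (ExtensionQuotient.bimodule f).envelopingModule n
  /-- `Tor_i^B(A / B, (A / B)^{⊗_B j}) = 0` for all `i, j ≥ 1`. -/
  tor_eq_zero : ∀ i j : ℕ, 1 ≤ i → 1 ≤ j →
    Limits.IsZero (torGroup B (ExtensionQuotient f)
      ((ExtensionQuotient.bimodule f).tensorPow j).carrier i)

end Extension

/-! ## Path algebras -/

/-- A quiver has no oriented cycles (in particular no loops): every path from a vertex to itself
is trivial. -/
def Quiver.IsAcyclicQuiver (Q : Type v) [Quiver.{w} Q] : Prop :=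
  ∀ (a : Q) (p : Quiver.Path a a), p = Quiver.Path.nil

/-- The set of all paths of a quiver, including the trivial ones. -/
def AllPaths (Q : Type v) [Quiver.{w} Q] : Type (max v w) :=
  Σ (a : Q) (b : Q), Quiver.Path a b

/-- The path algebra `kQ`: the `k`-vector space with basis the paths of `Q`. -/
def PathAlgebra (k : Type u) [Field k] (Q : Type v) [Quiver.{w} Q] : Type (max u v w) :=
  AllPaths Q →₀ k

namespace PathAlgebra

variable (k : Type u) [Field k] {Q : Type v} [Quiver.{w} Q]

instance : AddCommGroup (PathAlgebra k Q) := inferInstanceAs (AddCommGroup (AllPaths Q →₀ k))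

instance : Module k (PathAlgebra k Q) := inferInstanceAs (Module k (AllPaths Q →₀ k))

/-- The basis element of `kQ` given by a path. -/
def ofPath {a b : Q} (p : Quiver.Path a b) : PathAlgebra k Q :=
  Finsupp.single (⟨a, b, p⟩ : AllPaths Q) 1

variable {k} in
theorem lin_ext {V : Type*} [AddCommGroup V] [Module k V] {f g : PathAlgebra k Q →ₗ[k] V}
    (h : ∀ (a b : Q) (p : Quiver.Path a b), f (ofPath k p) = g (ofPath k p)) : f = g :=
  Finsupp.lhom_ext' fun ⟨a, b, p⟩ => LinearMap.ext_ring (h a b p)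

variable {k} in
/-- The linear map on `kQ` with prescribed values on the paths. -/
def linMap {V : Type*} [AddCommGroup V] [Module k V] (φ : AllPaths Q → V) :
    PathAlgebra k Q →ₗ[k] V :=
  Finsupp.lift V k (AllPaths Q) φ

variable {k} in
theorem linMap_ofPath {V : Type*} [AddCommGroup V] [Module k V] (φ : AllPaths Q → V) {a b : Q}
    (p : Quiver.Path a b) : linMap φ (ofPath k p) = φ ⟨a, b, p⟩ :=
  (Finsupp.sum_single_index (by simp)).trans (one_smul k _)

open Classical in
/-- The product `y x` of two paths: the concatenation "first `x`, then `y`" when `x` ends where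
`y` starts, and `0` otherwise. -/
def pathMul (y x : AllPaths Q) : PathAlgebra k Q :=
  if h : x.2.1 = y.1 then ofPath k ((x.2.2.cast rfl h).comp y.2.2) else 0

/-- The multiplication of `kQ` as a bilinear map. -/
def mulHom : PathAlgebra k Q →ₗ[k] PathAlgebra k Q →ₗ[k] PathAlgebra k Q :=
  linMap fun y => linMap fun x => pathMul k y x

instance : Mul (PathAlgebra k Q) := ⟨fun y x => mulHom k y x⟩

theorem mul_def (y x : PathAlgebra k Q) : y * x = mulHom k y x := rfl

theorem mul_ofPath {a b c d : Q} (y : Quiver.Path c d) (x : Quiver.Path a b) :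
    ofPath k y * ofPath k x = pathMul k ⟨c, d, y⟩ ⟨a, b, x⟩ := by
  rw [mul_def, mulHom, linMap_ofPath, linMap_ofPath]

theorem mul_ofPath_comp {a b c : Q} (y : Quiver.Path b c) (x : Quiver.Path a b) :
    ofPath k y * ofPath k x = ofPath k (x.comp y) := by
  rw [mul_ofPath]
  simp [pathMul]

theorem mul_ofPath_of_ne {a b c d : Q} (y : Quiver.Path c d) (x : Quiver.Path a b) (h : b ≠ c) :
    ofPath k y * ofPath k x = 0 := by
  rw [mul_ofPath]
  simp [pathMul, h]

theorem pa_mul_zero (x : PathAlgebra k Q) : x * 0 = 0 := map_zero (mulHom k x)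

theorem pa_zero_mul (x : PathAlgebra k Q) : 0 * x = 0 := by
  rw [mul_def, map_zero, LinearMap.zero_apply]

theorem pa_mul_assoc (x y z : PathAlgebra k Q) : x * y * z = x * (y * z) := by
  refine LinearMap.congr_fun (f := (mulHom k).flip z ∘ₗ (mulHom k).flip y)
    (g := (mulHom k).flip (y * z)) (lin_ext fun a b p => ?_) x
  refine LinearMap.congr_fun (f := (mulHom k).flip z ∘ₗ mulHom k (ofPath k p))
    (g := mulHom k (ofPath k p) ∘ₗ (mulHom k).flip z) (lin_ext fun c d q => ?_) y
  refine LinearMap.congr_fun (f := mulHom k (ofPath k p * ofPath k q))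
    (g := mulHom k (ofPath k p) ∘ₗ mulHom k (ofPath k q)) (lin_ext fun e f r => ?_) z
  change ofPath k p * ofPath k q * ofPath k r = ofPath k p * (ofPath k q * ofPath k r)
  by_cases h1 : d = a
  · subst h1
    rw [mul_ofPath_comp]
    by_cases h2 : f = c
    · subst h2
      simp only [mul_ofPath_comp, Quiver.Path.comp_assoc]
    · rw [mul_ofPath_of_ne k _ _ h2, mul_ofPath_of_ne k _ _ h2, pa_mul_zero]
  · rw [mul_ofPath_of_ne k _ _ h1, pa_zero_mul]
    by_cases h2 : f = c
    · subst h2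
      rw [mul_ofPath_comp, mul_ofPath_of_ne k _ _ h1]
    · rw [mul_ofPath_of_ne k _ _ h2, pa_mul_zero]

variable [Fintype Q]

/-- The unit of `kQ` is the sum of the trivial paths `e_a`. -/
instance : One (PathAlgebra k Q) := ⟨∑ a : Q, ofPath k (Quiver.Path.nil : Quiver.Path a a)⟩

theorem one_def : (1 : PathAlgebra k Q) = ∑ a : Q, ofPath k (Quiver.Path.nil : Quiver.Path a a) :=
  rfl

theorem pa_one_mul (x : PathAlgebra k Q) : 1 * x = x := by
  have h : mulHom k (1 : PathAlgebra k Q) = LinearMap.id := by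
    refine lin_ext fun a b p => ?_
    rw [one_def, map_sum, LinearMap.sum_apply, Finset.sum_eq_single b]
    · exact mul_ofPath_comp k _ _
    · exact fun c _ hc => mul_ofPath_of_ne k _ _ hc.symm
    · simp
  exact LinearMap.congr_fun h x

theorem pa_mul_one (x : PathAlgebra k Q) : x * 1 = x := by
  have h : (mulHom k).flip (1 : PathAlgebra k Q) = LinearMap.id := by
    refine lin_ext fun a b p => ?_
    rw [LinearMap.flip_apply, one_def, map_sum, Finset.sum_eq_single a]
    · exact (mul_ofPath_comp k _ _).trans (by simp)
    · exact fun c _ hc => mul_ofPath_of_ne k _ _ hc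
    · simp
  exact LinearMap.congr_fun h x

instance : Ring (PathAlgebra k Q) :=
  { (inferInstance : AddCommGroup (PathAlgebra k Q)),
    (inferInstance : Mul (PathAlgebra k Q)),
    (inferInstance : One (PathAlgebra k Q)) with
    left_distrib := fun x y z => map_add (mulHom k x) y z
    right_distrib := fun x y z => by simp [mul_def]
    zero_mul := fun x => by simp [mul_def]
    mul_zero := fun x => map_zero (mulHom k x)
    mul_assoc := pa_mul_assoc k
    one_mul := pa_one_mul k
    mul_one := pa_mul_one k }

instance : Algebra k (PathAlgebra k Q) :=
  Algebra.ofModule (fun c x y => by simp [mul_def])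
    (fun c x y => map_smul (mulHom k x) c y)

/-- The coefficient of the trivial path `e_a`, as a linear map. -/
def coeffNil (a : Q) : PathAlgebra k Q →ₗ[k] k :=
  Finsupp.lapply (⟨a, a, Quiver.Path.nil⟩ : AllPaths Q)

theorem coeffNil_nil (a : Q) : coeffNil k a (ofPath k (Quiver.Path.nil : Quiver.Path a a)) = 1 :=
  Finsupp.single_eq_same

theorem coeffNil_of_ne {a b c : Q} (p : Quiver.Path b c)
    (h : (⟨b, c, p⟩ : AllPaths Q) ≠ (⟨a, a, Quiver.Path.nil⟩ : AllPaths Q)) :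
    coeffNil k a (ofPath k p) = 0 :=
  Finsupp.single_eq_of_ne h.symm

theorem coeffNil_nil_of_ne {a b : Q} (h : b ≠ a) :
    coeffNil k a (ofPath k (Quiver.Path.nil : Quiver.Path b b)) = 0 :=
  coeffNil_of_ne k _ fun e => h (congrArg Sigma.fst e)

theorem coeffNil_cons (a : Q) {b c d : Q} (p : Quiver.Path b c) (f : c ⟶ d) :
    coeffNil k a (ofPath k (p.cons f)) = 0 := by
  refine coeffNil_of_ne k _ fun e => ?_
  have h : ∀ x : AllPaths Q, x = ⟨a, a, Quiver.Path.nil⟩ → x.2.2.length = 0 := by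
    rintro _ rfl
    rfl
  exact absurd (h _ e) (Nat.succ_ne_zero _)

/-- The coefficient of the trivial path `e_a`; it is an algebra homomorphism `kQ → k`. -/
def trivialCoeff (a : Q) : PathAlgebra k Q →ₐ[k] k :=
  AlgHom.ofLinearMap (coeffNil k a)
    (by
      rw [one_def, map_sum, Finset.sum_eq_single a]
      · exact coeffNil_nil k a
      · exact fun b _ hb => coeffNil_nil_of_ne k hb
      · simp)
    (fun x y => by
      refine LinearMap.congr_fun (f := coeffNil k a ∘ₗ (mulHom k).flip y)
        (g := LinearMap.mulRight k (coeffNil k a y) ∘ₗ coeffNil k a) (lin_ext fun b c p => ?_) x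
      refine LinearMap.congr_fun (f := coeffNil k a ∘ₗ mulHom k (ofPath k p))
        (g := LinearMap.mulLeft k (coeffNil k a (ofPath k p)) ∘ₗ coeffNil k a)
        (lin_ext fun d e q => ?_) y
      change coeffNil k a (ofPath k p * ofPath k q) =
        coeffNil k a (ofPath k p) * coeffNil k a (ofPath k q)
      by_cases h : e = b
      · subst h
        rw [mul_ofPath_comp]
        cases p with
        | cons p f => rw [Quiver.Path.comp_cons, coeffNil_cons, coeffNil_cons, zero_mul]
        | nil =>
          rw [Quiver.Path.comp_nil]
          by_cases he : c = a
          · subst he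
            rw [coeffNil_nil, one_mul]
          · rw [coeffNil_nil_of_ne k he, zero_mul]
            exact coeffNil_of_ne k _ fun e' => he
              (congrArg (fun x : AllPaths Q => x.2.1) e')
      · rw [mul_ofPath_of_ne k _ _ h, map_zero]
        symm
        by_cases hb : b = a
        · cases q with
          | cons q f => rw [coeffNil_cons, mul_zero]
          | nil => rw [coeffNil_nil_of_ne k (fun h' => h (h'.trans hb.symm)), mul_zero]
        · rw [coeffNil_of_ne k p fun e' => hb (congrArg Sigma.fst e'), zero_mul])

end PathAlgebra

section Simple

variable (k : Type u) [Field k] {Q : Type v} [Quiver.{w} Q] [Fintype Q]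

/-- The simple left `kQ`-module `S(a)` at the vertex `a`: the one-dimensional space `k` on which
`e_a` acts as the identity and all other paths act as `0`. -/
def LeftSimple (_a : Q) : Type u := k

/-- The simple right `kQ`-module `T(a)` at the vertex `a`: the one-dimensional space `k` on which
`e_a` acts as the identity and all other paths act as `0`. -/
def RightSimple (_a : Q) : Type u := k

variable (a b : Q)

instance : AddCommGroup (LeftSimple k a) := inferInstanceAs (AddCommGroup k)

instance : Module k (LeftSimple k a) := inferInstanceAs (Module k k)

instance : Module (PathAlgebra k Q) (LeftSimple k a) :=
  Module.compHom k (PathAlgebra.trivialCoeff k a).toRingHom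

instance : AddCommGroup (RightSimple k a) := inferInstanceAs (AddCommGroup k)

instance : Module k (RightSimple k a) := inferInstanceAs (Module k k)

instance : Module (PathAlgebra k Q)ᵐᵒᵖ (RightSimple k a) :=
  Module.compHom k
    ((PathAlgebra.trivialCoeff k a).toRingHom.fromOpposite fun _ _ => mul_comm _ _)

theorem LeftSimple.smul_def (x : PathAlgebra k Q) (m : LeftSimple k a) :
    x • m = PathAlgebra.trivialCoeff k a x • m := rfl

theorem RightSimple.smul_def (x : (PathAlgebra k Q)ᵐᵒᵖ) (m : RightSimple k a) :
    x • m = PathAlgebra.trivialCoeff k a x.unop • m := rfl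

instance : IsScalarTower k (PathAlgebra k Q) (LeftSimple k a) := ⟨fun c x m => by
  rw [LeftSimple.smul_def, LeftSimple.smul_def, map_smul, smul_assoc]⟩

instance : IsScalarTower k (PathAlgebra k Q)ᵐᵒᵖ (RightSimple k a) := ⟨fun c x m => by
  rw [RightSimple.smul_def, RightSimple.smul_def, MulOpposite.unop_smul, map_smul, smul_assoc]⟩

/-- The `kQ`-`kQ`-bimodule `S(a) ⊗_k T(b)`, with `x (s ⊗ t) y = x s ⊗ t y`. -/
abbrev SimpleTensor : Type u := LeftSimple k a ⊗[k] RightSimple k b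

/-- The operators `s ⊗ t ↦ s ⊗ t y` on `S(a) ⊗_k T(b)`. -/
def SimpleTensor.rightEnd : (PathAlgebra k Q)ᵐᵒᵖ →+* Module.End k (SimpleTensor k a b) where
  toFun y := LinearMap.lTensor (LeftSimple k a) (Algebra.lsmul k k (RightSimple k b) y)
  map_one' := by rw [map_one, Module.End.one_eq_id, LinearMap.lTensor_id]; rfl
  map_mul' y z := by rw [map_mul, LinearMap.lTensor_mul]
  map_zero' := by rw [map_zero, LinearMap.lTensor_zero]
  map_add' y z := by rw [map_add, LinearMap.lTensor_add]

instance : Module (PathAlgebra k Q)ᵐᵒᵖ (SimpleTensor k a b) :=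
  Module.compHom _ (SimpleTensor.rightEnd k a b)

theorem SimpleTensor.smul_tmul_left (x : PathAlgebra k Q) (s : LeftSimple k a)
    (t : RightSimple k b) : x • (s ⊗ₜ[k] t : SimpleTensor k a b) = (x • s) ⊗ₜ[k] t := rfl

theorem SimpleTensor.op_smul_tmul (y : (PathAlgebra k Q)ᵐᵒᵖ) (s : LeftSimple k a)
    (t : RightSimple k b) : y • (s ⊗ₜ[k] t : SimpleTensor k a b) = s ⊗ₜ[k] (y • t) := rfl

instance : IsScalarTower k (PathAlgebra k Q)ᵐᵒᵖ (SimpleTensor k a b) := ⟨fun c y m => by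
  induction m using TensorProduct.induction_on with
  | zero => simp only [smul_zero]
  | tmul s t =>
    rw [SimpleTensor.op_smul_tmul, SimpleTensor.op_smul_tmul, smul_assoc, TensorProduct.tmul_smul]
  | add m n hm hn => simp only [smul_add, hm, hn]⟩

instance : SMulCommClass (PathAlgebra k Q) (PathAlgebra k Q)ᵐᵒᵖ (SimpleTensor k a b) :=
  ⟨fun x y m => by
    induction m using TensorProduct.induction_on with
    | zero => simp only [smul_zero]
    | tmul s t => simp only [SimpleTensor.op_smul_tmul, SimpleTensor.smul_tmul_left]
    | add m n hm hn => simp only [smul_add, hm, hn]⟩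

end Simple

end

/-! Write `B = kQ`, with vertices `x`, `y` for `u`, `v`, and identify `A / B` with the
one-dimensional bimodule `M = S(x) ⊗ T(y)`. The idempotent `e_y` acts on `M` as the identity from
the right and, since `x ≠ y`, as zero from the left. Whenever `e_y` is the identity on the right of
`M` and zero on the left of `N`, one has `m ⊗ n = m e_y ⊗ n = m ⊗ e_y n = 0`, so `M ⊗_B N = 0`
(`BalancedTensor.subsingleton_of_idempotent`). With `N = M` this kills all tensor powers from the
second on, which gives nilpotency and the Tor condition for `j ≥ 2`.

For `j = 1` the coefficient module is `M ⊗_B B ≅ M ≅ S(x)` on the left. It has the resolution `0 →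
rad(B e_x) → B e_x → S(x) → 0`, whose kernel is projective: a nontrivial path from `x` factors
uniquely through its first arrow, which yields a dual basis (`projective_leftRad`). As no path leads
from `x` to `y`, `e_y B e_x = 0`, so the same idempotent argument kills `M ⊗_B rad(B e_x)` and with
it all higher Tor.

Both simples have such resolutions of length one. Tensoring them over the field `k` shows that `M`
has projective dimension at most 2 over `B ⊗ Bᵐᵒᵖ` (`hasProjectiveDimensionLE_envelopingModule`).

Finally, if `M` were projective on the left, the surjection `B → M` would split, and the image `b`
of a generator would satisfy `f b = 0` for an arrow `f` leaving `x`. The coefficient of `f` in `f b`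
is that of `e_x` in `b`, so `b` would act as zero on `M`, a contradiction. The right side is
symmetric. Acyclicity enters only through the finite dimension of `B`. -/

open CategoryTheory

noncomputable section

/-! ### Projective resolutions of length one and derived functors. -/

section TwoTerm

open scoped ZeroObject

variable {C : Type u} [Category.{v} C] [Abelian C] {K P : C}

/-- The chain complex `⋯ ⟶ 0 ⟶ K ⟶ P` in degrees `1` and `0`. -/
def twoTermComplex (f : K ⟶ P) : ChainComplex C ℕ where
  X
    | 0 => P
    | 1 => K
    | _ + 2 => 0
  d
    | 1, 0 => f
    | _, _ => 0
  shape
    | 1, 0, h => absurd rfl h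
    | 0, _, _ => rfl
    | 1, _ + 1, _ => rfl
    | _ + 2, _, _ => rfl
  d_comp_d'
    | _, _, 0, rfl, rfl => Limits.zero_comp
    | _, _, _ + 1, rfl, rfl => Limits.zero_comp

/-- A short exact sequence `0 ⟶ K ⟶ P ⟶ N ⟶ 0` with `K` and `P` projective is a projective
resolution of `N`. -/
def ProjectiveResolution.ofShortExact (S : ShortComplex C) (hS : S.ShortExact)
    [Projective S.X₁] [Projective S.X₂] : ProjectiveResolution S.X₃ where
  complex := twoTermComplex S.f
  projective
    | 0 => inferInstanceAs (Projective S.X₂)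
    | 1 => inferInstanceAs (Projective S.X₁)
    | _ + 2 => (Limits.isZero_zero C).projective
  π := ((twoTermComplex S.f).toSingle₀Equiv S.X₃).symm ⟨S.g, S.zero⟩
  quasiIso := ⟨fun n => by
    have := hS.mono_f
    have := hS.epi_g
    cases n with
    | zero =>
      -- In degree 0 the condition on `π` is exactness at `P` together with surjectivity onto `N`;
      -- the complex obtained is `S` up to identity isomorphisms.
      rw [ChainComplex.quasiIsoAt₀_iff, ShortComplex.quasiIso_iff_of_zeros']
      · refine (ShortComplex.exact_and_epi_g_iff_of_iso ?_).2 ⟨hS.exact, hS.epi_g⟩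
        refine ShortComplex.isoMk (Iso.refl _) (Iso.refl _) (Iso.refl _) ?_ ?_
        · exact (Category.id_comp _).trans (Category.comp_id _).symm
        · refine (Category.id_comp _).trans (Eq.trans ?_ (Category.comp_id _).symm)
          exact (ChainComplex.toSingle₀Equiv_symm_apply_f_zero
            (C := twoTermComplex S.f) S.g S.zero).symm
      all_goals rfl
    | succ n =>
      -- The target vanishes in positive degrees, so only exactness of the source is needed:
      -- injectivity of `f` in degree 1, and a zero object above.
      rw [quasiIsoAt_iff_exactAt' (hL := ChainComplex.exactAt_succ_single_obj ..),
        HomologicalComplex.exactAt_iff' _ (n + 2) (n + 1) n (by simp) (by simp)]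
      cases n with
      | zero =>
        refine (ShortComplex.exact_iff_mono _ rfl).2 ?_
        exact hS.mono_f
      | succ n => exact ShortComplex.exact_of_isZero_X₂ _ (Limits.isZero_zero C)⟩

/-- If an additive functor kills both terms of a projective resolution of length one, then it has
no higher derived functors at the resolved object. -/
theorem isZero_leftDerived_of_shortExact {D : Type*} [Category* D] [Abelian D]
    [HasProjectiveResolutions C] (F : C ⥤ D) [F.Additive] (S : ShortComplex C) (hS : S.ShortExact)
    [Projective S.X₁] [Projective S.X₂] (h : Limits.IsZero (F.obj S.X₁)) (i : ℕ) (hi : 1 ≤ i) :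
    Limits.IsZero ((F.leftDerived i).obj S.X₃) := by
  refine Limits.IsZero.of_iso ?_
    ((ProjectiveResolution.ofShortExact S hS).isoLeftDerivedObj F i)
  -- It suffices that the degree `i` term vanishes: this is `F K` for `i = 1` and `F 0` for `i ≥ 2`,
  -- so the value of `F` on `P` plays no role.
  refine ShortComplex.isZero_homology_of_isZero_X₂ _ ?_
  match i, hi with
  | 1, _ => exact h
  | _ + 2, _ => exact F.map_isZero (Limits.isZero_zero C)

end TwoTerm

/-! ### Vanishing of Tor and bounds on projective dimension. -/

section ModuleCat

variable {R : Type v} [Ring R] {X Y Z : Type v} [AddCommGroup X] [Module R X] [AddCommGroup Y]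
  [Module R Y] [AddCommGroup Z] [Module R Z]

/-- A short exact sequence of modules as a short complex. -/
abbrev linearShortComplex (f : X →ₗ[R] Y) (g : Y →ₗ[R] Z) (h : Function.Exact f g) :
    ShortComplex (ModuleCat.{v} R) :=
  ShortComplex.mk (ModuleCat.ofHom f) (ModuleCat.ofHom g)
    (by ext x; exact h.apply_apply_eq_zero x)

theorem linearShortComplex_shortExact (f : X →ₗ[R] Y) (g : Y →ₗ[R] Z) (h : Function.Exact f g)
    (hf : Function.Injective f) (hg : Function.Surjective g) :
    (linearShortComplex f g h).ShortExact where
  exact := (ShortComplex.ShortExact.moduleCat_exact_iff_function_exact _).2 h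
  mono_f := (ModuleCat.mono_iff_injective _).2 hf
  epi_g := (ModuleCat.epi_iff_surjective _).2 hg

/-- Moving `e` across the tensor sign gives `m ⊗ n = m e ⊗ n = m ⊗ e n = 0`. Both the nilpotency and
the Tor condition rest on this. -/
theorem BalancedTensor.subsingleton_of_idempotent {M N : Type*} [AddCommGroup M] [Module Rᵐᵒᵖ M]
    [AddCommGroup N] [Module R N] (e : R) (hM : ∀ m : M, MulOpposite.op e • m = m)
    (hN : ∀ n : N, e • n = 0) : Subsingleton (BalancedTensor R M N) := by
  have h : AddMonoidHom.id (BalancedTensor R M N) = 0 := BalancedTensor.hom_ext fun m n => by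
    change BalancedTensor.tmul R m n = 0
    rw [← hM m, BalancedTensor.smul_tmul, hN, BalancedTensor.tmul_zero]
  exact subsingleton_of_forall_eq 0 fun t => DFunLike.congr_fun h t

/-- `Tor` vanishes in positive degrees when an idempotent acts as the identity on `M` and by zero on
the syzygy `K` of a projective resolution `0 → K → P → N → 0`. -/
theorem isZero_torGroup_of_idempotent (M : Type v) [AddCommGroup M] [Module Rᵐᵒᵖ M]
    (f : X →ₗ[R] Y) (g : Y →ₗ[R] Z) (h : Function.Exact f g)
    (hf : Function.Injective f) (hg : Function.Surjective g)
    [Module.Projective R X] [Module.Projective R Y] (e : R)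
    (hM : ∀ m : M, MulOpposite.op e • m = m) (hX : ∀ x : X, e • x = 0) (i : ℕ) (hi : 1 ≤ i) :
    Limits.IsZero (torGroup R M Z i) := by
  have : Projective (linearShortComplex f g h).X₁ :=
    (IsProjective.iff_projective (R := R) X).1 inferInstance
  have : Projective (linearShortComplex f g h).X₂ :=
    (IsProjective.iff_projective (R := R) Y).1 inferInstance
  refine isZero_leftDerived_of_shortExact (tensorFunctor R M) _
    (linearShortComplex_shortExact f g h hf hg) ?_ i hi
  have := BalancedTensor.subsingleton_of_idempotent e hM hX
  exact AddCommGrpCat.isZero_of_subsingleton (AddCommGrpCat.of (BalancedTensor R M X))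

/-- The zero module is projective and resolves itself by `0 → Z → Z → Z → 0`; the element `1` then
serves as the idempotent. -/
theorem isZero_torGroup_of_subsingleton (M : Type v) [AddCommGroup M] [Module Rᵐᵒᵖ M]
    [Subsingleton Z] (i : ℕ) (hi : 1 ≤ i) : Limits.IsZero (torGroup R M Z i) :=
  have : Module.Projective R Z := ⟨0, fun _ => Subsingleton.elim _ _⟩
  isZero_torGroup_of_idempotent M (0 : Z →ₗ[R] Z) (0 : Z →ₗ[R] Z)
    (fun _ => ⟨fun _ => ⟨0, Subsingleton.elim _ _⟩, fun _ => Subsingleton.elim _ _⟩)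
    (Function.injective_of_subsingleton _) (Function.surjective_to_subsingleton _) 1
    (fun m => one_smul _ m) (fun _ => Subsingleton.elim _ _) i hi

theorem hasProjectiveDimensionLT_of_exact
    (f : X →ₗ[R] Y) (g : Y →ₗ[R] Z) (h : Function.Exact f g)
    (hf : Function.Injective f) (hg : Function.Surjective g) (n : ℕ)
    (hX : HasProjectiveDimensionLT (ModuleCat.of R X) n)
    (hY : HasProjectiveDimensionLT (ModuleCat.of R Y) (n + 1)) :
    HasProjectiveDimensionLT (ModuleCat.of R Z) (n + 1) :=
  (linearShortComplex_shortExact f g h hf hg).hasProjectiveDimensionLT_X₃ n hX hY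

theorem hasProjectiveDimensionLT_one_of_projective [Module.Projective R X] :
    HasProjectiveDimensionLT (ModuleCat.of R X) 1 :=
  projective_iff_hasProjectiveDimensionLT_one.1
    ((IsProjective.iff_projective (R := R) X).1 inferInstance)

end ModuleCat

/-! ### External tensor products of modules over `A ⊗_k C`. -/

section ExternalTensor

variable (k : Type u) [Field k] (A C M N : Type*) [AddCommGroup M] [Module k M] [AddCommGroup N]
  [Module k N]

/-- The tensor product `M ⊗_k N` of an `A`-module and a `C`-module, as a module over `A ⊗_k C`. -/
def ExternalTensor (_A _C : Type*) (M N : Type*) [AddCommGroup M] [Module k M]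
    [AddCommGroup N] [Module k N] : Type _ := M ⊗[k] N

namespace ExternalTensor

instance : AddCommGroup (ExternalTensor k A C M N) := inferInstanceAs (AddCommGroup (M ⊗[k] N))

instance : Module k (ExternalTensor k A C M N) := inferInstanceAs (Module k (M ⊗[k] N))

variable {M N}

/-- The pure tensors. -/
def tmul (m : M) (n : N) : ExternalTensor k A C M N := m ⊗ₜ[k] n

theorem tmul_add (m : M) (n n' : N) : tmul k A C m (n + n') = tmul k A C m n + tmul k A C m n' :=
  TensorProduct.tmul_add m n n'

theorem add_tmul (m m' : M) (n : N) : tmul k A C (m + m') n = tmul k A C m n + tmul k A C m' n :=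
  TensorProduct.add_tmul m m' n

theorem tmul_zero (m : M) : tmul k A C m (0 : N) = 0 := TensorProduct.tmul_zero N m

theorem zero_tmul (n : N) : tmul k A C (0 : M) n = 0 := TensorProduct.zero_tmul M n

variable {k A C} in
theorem induction_on {p : ExternalTensor k A C M N → Prop} (x : ExternalTensor k A C M N)
    (zero : p 0) (tmul : ∀ m n, p (tmul k A C m n)) (add : ∀ x y, p x → p y → p (x + y)) : p x :=
  TensorProduct.induction_on (motive := p) x zero tmul add

variable (M N) [Ring A] [Algebra k A] [Ring C] [Algebra k C] [Module A M] [IsScalarTower k A M]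
  [Module C N] [IsScalarTower k C N]

/-- The action of `A ⊗_k C` on `M ⊗_k N`. -/
def action : A ⊗[k] C →ₐ[k] Module.End k (M ⊗[k] N) :=
  (Module.endTensorEndAlgHom (R := k) (S := k) (A := k) (M := M) (N := N)).comp
    (Algebra.TensorProduct.map (Algebra.lsmul k k M) (Algebra.lsmul k k N))

instance : Module (A ⊗[k] C) (ExternalTensor k A C M N) :=
  Module.compHom (M ⊗[k] N) (action k A C M N).toRingHom

variable {M N}

theorem tmul_smul_tmul (a : A) (c : C) (m : M) (n : N) :
    (a ⊗ₜ[k] c) • tmul k A C m n = tmul k A C (a • m) (c • n) := rfl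

variable {M' N' : Type*} [AddCommGroup M'] [Module k M'] [Module A M'] [IsScalarTower k A M']
  [AddCommGroup N'] [Module k N'] [Module C N'] [IsScalarTower k C N']

variable {k A C} in
/-- An additive map out of `M ⊗_k N` is `A ⊗_k C`-linear if it is so on pure tensors. -/
def linearMapOfTmul {X : Type*} [AddCommGroup X] [Module (A ⊗[k] C) X]
    (φ : ExternalTensor k A C M N →+ X)
    (h : ∀ (a : A) (c : C) (m : M) (n : N),
      φ (tmul k A C (a • m) (c • n)) = (a ⊗ₜ[k] c) • φ (tmul k A C m n)) :
    ExternalTensor k A C M N →ₗ[A ⊗[k] C] X where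
  toFun := φ
  map_add' := map_add φ
  map_smul' r x := by
    rw [RingHom.id_apply]
    induction r using TensorProduct.induction_on with
    | zero => rw [zero_smul, zero_smul, map_zero]
    | add r s hr hs => rw [add_smul, map_add, hr, hs, add_smul]
    | tmul a c =>
      induction x using induction_on with
      | zero => rw [smul_zero, map_zero, smul_zero]
      | add x y hx hy => rw [smul_add, map_add, hx, hy, map_add, smul_add]
      | tmul m n => rw [tmul_smul_tmul, h]

/-- The map `f ⊗ g`, for an `A`-linear map `f` and a `C`-linear map `g`. -/
def map (f : M →ₗ[A] M') (g : N →ₗ[C] N') :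
    ExternalTensor k A C M N →ₗ[A ⊗[k] C] ExternalTensor k A C M' N' :=
  linearMapOfTmul
    (TensorProduct.map (f.restrictScalars k) (g.restrictScalars k)).toAddMonoidHom
    fun a c m n => by
      change f (a • m) ⊗ₜ[k] g (c • n) = (a • f m) ⊗ₜ[k] (c • g n)
      rw [map_smul, map_smul]

theorem map_tmul (f : M →ₗ[A] M') (g : N →ₗ[C] N') (m : M) (n : N) :
    map k A C f g (tmul k A C m n) = tmul k A C (f m) (g n) := rfl

section Exact

variable {M'' : Type*} [AddCommGroup M''] [Module k M''] [Module A M''] [IsScalarTower k A M'']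

/-- Over the field `k` every module is flat, so tensoring with a fixed factor preserves short exact
sequences in either variable. This and the following lemmas lift the resolutions of the simples to
`A ⊗_k C`. -/
theorem map_id_injective (f : M →ₗ[A] M') (hf : Function.Injective f) :
    Function.Injective (map k A C f (LinearMap.id : N →ₗ[C] N)) :=
  Module.Flat.rTensor_preserves_injective_linearMap (f.restrictScalars k) hf

theorem map_id_surjective (f : M →ₗ[A] M') (hf : Function.Surjective f) :
    Function.Surjective (map k A C f (LinearMap.id : N →ₗ[C] N)) :=
  LinearMap.rTensor_surjective N (g := f.restrictScalars k) hf

theorem map_id_exact (f : M →ₗ[A] M') (g : M' →ₗ[A] M'') (h : Function.Exact f g) :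
    Function.Exact (map k A C f (LinearMap.id : N →ₗ[C] N))
      (map k A C g (LinearMap.id : N →ₗ[C] N)) :=
  Module.Flat.rTensor_exact (f := f.restrictScalars k) (g := g.restrictScalars k) N h

theorem id_map_injective (f : N →ₗ[C] N') (hf : Function.Injective f) :
    Function.Injective (map k A C (LinearMap.id : M →ₗ[A] M) f) :=
  Module.Flat.lTensor_preserves_injective_linearMap (f.restrictScalars k) hf

theorem id_map_surjective (f : N →ₗ[C] N') (hf : Function.Surjective f) :
    Function.Surjective (map k A C (LinearMap.id : M →ₗ[A] M) f) :=
  LinearMap.lTensor_surjective M (g := f.restrictScalars k) hf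

variable {N'' : Type*} [AddCommGroup N''] [Module k N''] [Module C N''] [IsScalarTower k C N'']

theorem id_map_exact (f : N →ₗ[C] N') (g : N' →ₗ[C] N'') (h : Function.Exact f g) :
    Function.Exact (map k A C (LinearMap.id : M →ₗ[A] M) f)
      (map k A C (LinearMap.id : M →ₗ[A] M) g) :=
  Module.Flat.lTensor_exact (f := f.restrictScalars k) (g := g.restrictScalars k) M h

end Exact

/-- The tensor product of two free modules, as a free `A ⊗_k C`-module. -/
def finsuppHom (ι κ : Type*) :
    ExternalTensor k A C (ι →₀ A) (κ →₀ C) →ₗ[A ⊗[k] C] (ι × κ →₀ A ⊗[k] C) :=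
  linearMapOfTmul (finsuppTensorFinsupp k k A C ι κ).toLinearMap.toAddMonoidHom
    fun a c f g => by
      ext ⟨i, j⟩
      change finsuppTensorFinsupp k k A C ι κ ((a • f) ⊗ₜ (c • g)) (i, j) =
        (a ⊗ₜ[k] c) * finsuppTensorFinsupp k k A C ι κ (f ⊗ₜ g) (i, j)
      rw [finsuppTensorFinsupp_apply, finsuppTensorFinsupp_apply,
        Algebra.TensorProduct.tmul_mul_tmul]
      rfl

theorem finsuppHom_single {ι κ : Type*} (i : ι) (j : κ) (a : A) (c : C) :
    finsuppHom k A C ι κ (tmul k A C (Finsupp.single i a) (Finsupp.single j c)) =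
      Finsupp.single (i, j) (a ⊗ₜ c) :=
  finsuppTensorFinsupp_single k k A C ι κ i a j c

/-- The canonical surjections from the free modules on `M` and on `N` tensor to the one from the
free module on pure tensors; this makes sections of the two factors combine. -/
theorem linearCombination_finsuppHom (f : M →₀ A) (g : N →₀ C) :
    Finsupp.linearCombination (A ⊗[k] C) (fun p : M × N => tmul k A C p.1 p.2)
        (finsuppHom k A C M N (tmul k A C f g)) =
      tmul k A C (Finsupp.linearCombination A id f) (Finsupp.linearCombination C id g) := by
  induction f using Finsupp.induction_linear with
  | zero => simp only [map_zero, zero_tmul]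
  | add f f' h h' => simp only [map_add, add_tmul, h, h']
  | single m a =>
    induction g using Finsupp.induction_linear with
    | zero => simp only [map_zero, tmul_zero]
    | add f f' h h' => simp only [map_add, tmul_add, h, h']
    | single n c =>
      rw [finsuppHom_single, Finsupp.linearCombination_single, Finsupp.linearCombination_single,
        Finsupp.linearCombination_single, tmul_smul_tmul]
      rfl

/-- If `s` and `t` split the canonical free covers of `M` and `N`, then `s ⊗ t` splits the cover of
`M ⊗_k N` by the free module on `M × N`. -/
theorem projective [hM : Module.Projective A M] [hN : Module.Projective C N] :
    Module.Projective (A ⊗[k] C) (ExternalTensor k A C M N) := by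
  obtain ⟨s, hs⟩ := hM
  obtain ⟨t, ht⟩ := hN
  refine Module.Projective.of_split (finsuppHom k A C M N ∘ₗ map k A C s t)
    (Finsupp.linearCombination (A ⊗[k] C) fun p : M × N => tmul k A C p.1 p.2)
    (LinearMap.ext fun x => ?_)
  induction x using induction_on with
  | zero => exact map_zero _
  | add x y hx hy => rw [map_add, hx, hy, map_add]
  | tmul m n =>
    rw [LinearMap.comp_apply, LinearMap.comp_apply, map_tmul, linearCombination_finsuppHom, hs, ht,
      LinearMap.id_apply]

end ExternalTensor

end ExternalTensor

/-! ### Criteria for left ideals to be projective. -/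

/-- Right multiplication by `e` is a retraction of `A` onto `A e`. -/
theorem Ideal.projective_span_singleton {A : Type*} [Ring A] {e : A} (he : IsIdempotentElem e) :
    Module.Projective A (Ideal.span {e}) := by
  refine Module.Projective.of_split (M := A) (Submodule.subtype _)
    ((LinearMap.toSpanSingleton A A e).codRestrict _ fun a =>
      Ideal.mem_span_singleton'.2 ⟨a, rfl⟩) ?_
  ext ⟨b, hb⟩
  obtain ⟨a, rfl⟩ := Ideal.mem_span_singleton'.1 hb
  simp [mul_assoc, he.eq]

theorem Ideal.mul_eq_of_mem_span_singleton {A : Type*} [Ring A] {e : A}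
    (he : IsIdempotentElem e) {b : A} (hb : b ∈ Ideal.span {e}) : b * e = b := by
  obtain ⟨a, rfl⟩ := Ideal.mem_span_singleton'.1 hb
  rw [mul_assoc, he.eq]

/-- A left ideal with a dual basis is projective. -/
theorem Ideal.projective_of_dualBasis {A : Type*} [Ring A] (J : Ideal A) {ι : Type*} (α : ι → A)
    (hα : ∀ i, α i ∈ J) (D : A →+ (ι →₀ A)) (hD : ∀ b, ∀ c ∈ J, D (b * c) = b • D c)
    (hs : ∀ c ∈ J, Finsupp.linearCombination A α (D c) = c) : Module.Projective A J := by
  let s : J →ₗ[A] (ι →₀ A) :=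
    { toFun := fun c => D c
      map_add' := fun b c => map_add D _ _
      map_smul' := fun b c => hD b c c.2 }
  refine Module.Projective.of_split s
    (Finsupp.linearCombination A fun i => (⟨α i, hα i⟩ : J)) ?_
  ext c
  have h := hs c c.2
  rw [Finsupp.linearCombination_apply] at h
  simp only [LinearMap.comp_apply, Finsupp.linearCombination_apply, LinearMap.id_apply]
  rw [← h, Finsupp.sum, Finsupp.sum, AddSubmonoidClass.coe_finsetSum]
  rfl

/-! ### First arrows of paths: the radical of `kQ e_x` is projective. -/

namespace PathAlgebra

variable (k : Type u) [Field k] {Q : Type v} [Quiver.{w} Q]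

variable {k} in
theorem induction {p : PathAlgebra k Q → Prop} (zero : p 0) (add : ∀ x y, p x → p y → p (x + y))
    (smul : ∀ (c : k) x, p x → p (c • x))
    (ofPath : ∀ (a b : Q) (r : Quiver.Path a b), p (ofPath k r)) (x : PathAlgebra k Q) : p x := by
  refine Finsupp.induction_linear (motive := p) x zero add fun ⟨a, b, r⟩ c => ?_
  have h := smul c _ (ofPath a b r)
  have e : c • PathAlgebra.ofPath k r = Finsupp.single (⟨a, b, r⟩ : AllPaths Q) c :=
    (Finsupp.smul_single _ _ _).trans (congrArg _ (mul_one c))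
  rwa [e] at h

/-- The trivial path `e_a`. -/
abbrev vertex (a : Q) : PathAlgebra k Q := ofPath k (Quiver.Path.nil : Quiver.Path a a)

theorem vertex_mul {a b : Q} (p : Quiver.Path a b) : vertex k b * ofPath k p = ofPath k p :=
  mul_ofPath_comp k _ _

theorem mul_vertex {a b : Q} (p : Quiver.Path a b) : ofPath k p * vertex k a = ofPath k p := by
  rw [mul_ofPath_comp, Quiver.Path.nil_comp]

theorem isIdempotentElem_vertex (a : Q) : IsIdempotentElem (vertex k a) :=
  vertex_mul k _

variable [Fintype Q]

theorem trivialCoeff_vertex (a : Q) : trivialCoeff k a (vertex k a) = 1 := coeffNil_nil k a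

theorem trivialCoeff_vertex_of_ne {a b : Q} (h : b ≠ a) : trivialCoeff k a (vertex k b) = 0 :=
  coeffNil_nil_of_ne k h

theorem trivialCoeff_cons (a : Q) {b c d : Q} (p : Quiver.Path b c) (f : c ⟶ d) :
    trivialCoeff k a (ofPath k (p.cons f)) = 0 := coeffNil_cons k a p f

theorem trivialCoeff_of_source_ne {a b c : Q} (p : Quiver.Path b c) (h : b ≠ a) :
    trivialCoeff k a (ofPath k p) = 0 :=
  coeffNil_of_ne k p fun e => h (congrArg Sigma.fst e)

theorem trivialCoeff_of_target_ne {a b c : Q} (p : Quiver.Path b c) (h : c ≠ a) :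
    trivialCoeff k a (ofPath k p) = 0 :=
  coeffNil_of_ne k p fun e => h (congrArg (fun z : AllPaths Q => z.2.1) e)

/-- The arrows of a quiver. -/
abbrev Arrows (Q : Type v) [Quiver.{w} Q] : Type (max v w) := Σ (a b : Q), (a ⟶ b)

/-- The element of `⨁ kQ` over the arrows that records the decomposition `p = p' α` of a nontrivial
path into its first arrow `α` and the remaining path `p'`. -/
def firstArrow : {a b : Q} → Quiver.Path a b → (Arrows Q →₀ PathAlgebra k Q)
  | _, _, .nil => 0
  | a, b, .cons .nil f => Finsupp.single ⟨a, b, f⟩ (vertex k b)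
  | a, c, .cons (b := b) (.cons p g) f =>
    ofPath k (Quiver.Hom.toPath f : Quiver.Path b c) • firstArrow (a := a) (b := b) (.cons p g)

theorem firstArrow_cons {a b c : Q} (p : Quiver.Path a b) (hp : p.length ≠ 0) (f : b ⟶ c) :
    firstArrow k (p.cons f) = ofPath k f.toPath • firstArrow k p := by
  cases p with
  | nil => simp at hp
  | cons p g => rw [firstArrow]

theorem vertex_smul_firstArrow {a b : Q} (p : Quiver.Path a b) :
    vertex k b • firstArrow k p = firstArrow k p := by
  cases p with
  | nil => simp [firstArrow]
  | cons p f =>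
    cases p with
    | nil => rw [firstArrow, Finsupp.smul_single, smul_eq_mul, vertex_mul]
    | cons p g => rw [firstArrow, smul_smul, vertex_mul]

theorem smul_firstArrow_comp {a b c : Q} (p : Quiver.Path a b) (hp : p.length ≠ 0)
    (q : Quiver.Path b c) : firstArrow k (p.comp q) = ofPath k q • firstArrow k p := by
  induction q with
  | nil => rw [Quiver.Path.comp_nil, vertex_smul_firstArrow]
  | cons q f ih =>
    rw [Quiver.Path.comp_cons, firstArrow_cons _ _ (by simp [hp]), ih, smul_smul, mul_ofPath_comp]
    rfl

theorem linearCombination_firstArrow {a b : Q} (p : Quiver.Path a b) :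
    Finsupp.linearCombination (PathAlgebra k Q)
      (fun f : Arrows Q => ofPath k f.2.2.toPath * vertex k a) (firstArrow k p) =
      ofPath k p - trivialCoeff k a (ofPath k p) • vertex k a := by
  induction p with
  | nil => simp [firstArrow, trivialCoeff_vertex]
  | cons p f ih =>
    rw [trivialCoeff_cons, zero_smul, sub_zero]
    cases p with
    | nil =>
      rw [firstArrow, Finsupp.linearCombination_single, smul_eq_mul, mul_vertex, vertex_mul]
      rfl
    | cons p g =>
      rw [firstArrow, map_smul, ih, trivialCoeff_cons, zero_smul, sub_zero, smul_eq_mul,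
        mul_ofPath_comp]
      rfl

open Classical in
/-- The linear extension of `firstArrow` to the paths that start at `x`. -/
def firstArrowHom (x : Q) : PathAlgebra k Q →ₗ[k] (Arrows Q →₀ PathAlgebra k Q) :=
  linMap fun p => if p.1 = x then firstArrow k p.2.2 else 0

theorem firstArrowHom_ofPath {x b : Q} (p : Quiver.Path x b) :
    firstArrowHom k x (ofPath k p) = firstArrow k p := by
  rw [firstArrowHom, linMap_ofPath, if_pos rfl]

theorem firstArrowHom_of_ne {x a b : Q} (p : Quiver.Path a b) (h : a ≠ x) :
    firstArrowHom k x (ofPath k p) = 0 := by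
  rw [firstArrowHom, linMap_ofPath, if_neg h]

/-- A product rule of Fox-calculus type: `firstArrowHom` is a derivation twisted by the augmentation
`trivialCoeff k x`, hence linear over `kQ` on the second argument as soon as that augmentation
vanishes. -/
theorem firstArrowHom_mul (x : Q) (b c : PathAlgebra k Q) :
    firstArrowHom k x (b * c) =
      b • firstArrowHom k x c + trivialCoeff k x c • firstArrowHom k x b := by
  induction b using induction with
  | zero => simp
  | add b b' h h' => simp only [add_mul, map_add, h, h', add_smul, smul_add]; abel
  | smul t b h =>
    simp only [smul_mul_assoc, map_smul, h, smul_add, smul_assoc, smul_comm t]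
  | ofPath d e q =>
    induction c using induction with
    | zero => simp
    | add b b' h h' => simp only [mul_add, map_add, h, h', add_smul, smul_add]; abel
    | smul t b h =>
      simp only [mul_smul_comm, map_smul, h, smul_add, smul_eq_mul, mul_smul,
        smul_comm (ofPath k q) t]
    | ofPath a b p =>
      by_cases ha : a = x
      · subst ha
        rw [firstArrowHom_ofPath]
        by_cases hbd : b = d
        · subst hbd
          rw [mul_ofPath_comp, firstArrowHom_ofPath]
          cases p with
          | nil =>
            rw [trivialCoeff_vertex, Quiver.Path.nil_comp, firstArrowHom_ofPath]
            simp [firstArrow]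
          | cons p f =>
            rw [smul_firstArrow_comp _ _ (by simp), trivialCoeff_cons, zero_smul, add_zero]
        -- The product is zero, and `q` kills `firstArrow k p = e_b • firstArrow k p`. In the
        -- remaining term either `p` ends at `a`, so that `q` does not start there and has image
        -- zero, or `p` is nontrivial and its augmentation vanishes.
        · rw [mul_ofPath_of_ne _ _ _ hbd, map_zero, ← vertex_smul_firstArrow, smul_smul,
            mul_ofPath_of_ne _ _ _ hbd, zero_smul, zero_add]
          by_cases hb : b = a
          · rw [firstArrowHom_of_ne _ _ (fun h => hbd (hb.trans h.symm)), smul_zero]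
          · rw [trivialCoeff_of_target_ne _ _ hb, zero_smul]
      · rw [firstArrowHom_of_ne _ _ ha, trivialCoeff_of_source_ne _ _ ha, smul_zero, zero_smul,
          add_zero]
        by_cases hbd : b = d
        · subst hbd
          rw [mul_ofPath_comp, firstArrowHom_of_ne _ _ ha]
        · rw [mul_ofPath_of_ne _ _ _ hbd, map_zero]

/-- The counterpart of the fundamental formula of Fox calculus: reassembling a path from its first
arrow loses only the trivial part. On `leftRad k x` the right side is `c` itself, which is the dual
basis identity. -/
theorem linearCombination_firstArrowHom (x : Q) (c : PathAlgebra k Q) :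
    Finsupp.linearCombination (PathAlgebra k Q)
      (fun f : Arrows Q => ofPath k f.2.2.toPath * vertex k x) (firstArrowHom k x c) =
      c * vertex k x - trivialCoeff k x c • vertex k x := by
  induction c using induction with
  | zero => simp
  | add b c h h' => simp only [map_add, h, h', add_mul, add_smul]; abel
  | smul t b h =>
    simp only [map_smul, smul_mul_assoc, smul_assoc, ← smul_sub, ← h]
    rw [← algebraMap_smul (PathAlgebra k Q) t (firstArrowHom k x b), map_smul, algebraMap_smul]
  | ofPath a b p =>
    by_cases h : a = x
    · subst h
      rw [firstArrowHom_ofPath, linearCombination_firstArrow, mul_vertex]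
    · rw [firstArrowHom_of_ne _ _ h, mul_ofPath_of_ne _ _ _ (Ne.symm h),
        trivialCoeff_of_source_ne _ _ h, map_zero, zero_smul, sub_zero]

/-- The left ideal spanned by the nontrivial paths that start at `x`. -/
def leftRad (x : Q) : Ideal (PathAlgebra k Q) :=
  Ideal.span {vertex k x} ⊓ RingHom.ker (trivialCoeff k x)

/-- The dual basis is indexed by all arrows; the factor `e_x` makes the generators of arrows not
starting at `x` zero. -/
theorem projective_leftRad (x : Q) : Module.Projective (PathAlgebra k Q) (leftRad k x) := by
  refine Ideal.projective_of_dualBasis _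
    (fun f : Arrows Q => ofPath k f.2.2.toPath * vertex k x) (fun f => ?_)
    (firstArrowHom k x).toAddMonoidHom (fun b c hc => ?_) fun c hc => ?_
  · refine ⟨Ideal.mem_span_singleton'.2 ⟨_, rfl⟩, ?_⟩
    change trivialCoeff k x _ = 0
    rw [map_mul]
    exact mul_eq_zero_of_left (trivialCoeff_cons k x _ _) _
  · have h : trivialCoeff k x c = 0 := hc.2
    exact (firstArrowHom_mul k x b c).trans (by rw [h, zero_smul, add_zero]; rfl)
  · have h : trivialCoeff k x c = 0 := hc.2
    refine (linearCombination_firstArrowHom k x c).trans ?_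
    rw [h, zero_smul, sub_zero,
      Ideal.mul_eq_of_mem_span_singleton (isIdempotentElem_vertex k x) hc.1]

/-! ### Last arrows of paths: the radical of `e_y kQ` is projective. -/

/-- The element of `⨁ kQᵒᵖ` over the arrows that records the decomposition `p = α p'` of a
nontrivial path into its last arrow `α` and the remaining path `p'`. -/
def lastArrow : {a b : Q} → Quiver.Path a b → (Arrows Q →₀ (PathAlgebra k Q)ᵐᵒᵖ)
  | _, _, .nil => 0
  | _, _, .cons p f => Finsupp.single ⟨_, _, f⟩ (MulOpposite.op (ofPath k p))

open Classical in
/-- The linear extension of `lastArrow` to the paths that end at `y`. -/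
def lastArrowHom (y : Q) : PathAlgebra k Q →ₗ[k] (Arrows Q →₀ (PathAlgebra k Q)ᵐᵒᵖ) :=
  linMap fun p => if p.2.1 = y then lastArrow k p.2.2 else 0

theorem lastArrowHom_ofPath {y a : Q} (p : Quiver.Path a y) :
    lastArrowHom k y (ofPath k p) = lastArrow k p := by
  rw [lastArrowHom, linMap_ofPath, if_pos rfl]

theorem lastArrowHom_of_ne {y a b : Q} (p : Quiver.Path a b) (h : b ≠ y) :
    lastArrowHom k y (ofPath k p) = 0 := by
  rw [lastArrowHom, linMap_ofPath, if_neg h]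

/-- The mirror image of `firstArrowHom_mul`, with right multiplication expressed through the
opposite algebra. -/
theorem lastArrowHom_mul (y : Q) (c b : PathAlgebra k Q) :
    lastArrowHom k y (c * b) =
      MulOpposite.op b • lastArrowHom k y c + trivialCoeff k y c • lastArrowHom k y b := by
  induction c using induction with
  | zero => simp
  | add b b' h h' => simp only [add_mul, map_add, h, h', add_smul, smul_add]; abel
  | smul t b h =>
    simp only [smul_mul_assoc, map_smul, h, smul_add, smul_assoc, smul_comm t]
  | ofPath d e q =>
    induction b using induction with
    | zero => simp
    | add b b' h h' =>
      simp only [mul_add, map_add, h, h', add_smul, smul_add, MulOpposite.op_add]; abel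
    | smul t b h =>
      simp only [mul_smul_comm, map_smul, h, smul_add, smul_assoc, MulOpposite.op_smul]
      congr 1
      exact (smul_comm _ _ _)
    | ofPath a b p =>
      by_cases he : e = y
      · subst he
        rw [lastArrowHom_ofPath]
        by_cases hbd : b = d
        · subst hbd
          rw [mul_ofPath_comp, lastArrowHom_ofPath]
          cases q with
          | nil =>
            rw [trivialCoeff_vertex, Quiver.Path.comp_nil, lastArrowHom_ofPath]
            simp [lastArrow]
          | cons q f =>
            rw [trivialCoeff_cons, zero_smul, add_zero, Quiver.Path.comp_cons, lastArrow, lastArrow,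
              Finsupp.smul_single, smul_eq_mul, ← MulOpposite.op_mul, mul_ofPath_comp]
        · rw [mul_ofPath_of_ne _ _ _ hbd, map_zero]
          cases q with
          | nil => rw [lastArrowHom_of_ne _ _ hbd]; simp [lastArrow]
          | cons q f =>
            rw [trivialCoeff_cons, zero_smul, add_zero, lastArrow, Finsupp.smul_single, smul_eq_mul,
              ← MulOpposite.op_mul, mul_ofPath_of_ne _ _ _ hbd, MulOpposite.op_zero,
              Finsupp.single_zero]
      · rw [lastArrowHom_of_ne _ _ he, trivialCoeff_of_target_ne _ _ he, smul_zero, zero_smul,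
          add_zero]
        by_cases hbd : b = d
        · subst hbd
          rw [mul_ofPath_comp, lastArrowHom_of_ne _ _ he]
        · rw [mul_ofPath_of_ne _ _ _ hbd, map_zero]

theorem linearCombination_lastArrowHom (y : Q) (c : PathAlgebra k Q) :
    Finsupp.linearCombination (PathAlgebra k Q)ᵐᵒᵖ
      (fun f : Arrows Q => MulOpposite.op (vertex k y * ofPath k f.2.2.toPath))
      (lastArrowHom k y c) =
      MulOpposite.op (vertex k y * c - trivialCoeff k y c • vertex k y) := by
  induction c using induction with
  | zero => simp
  | add b c h h' =>
    simp only [map_add, h, h', mul_add, add_smul, ← MulOpposite.op_add]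
    congr 1
    abel
  | smul t b h =>
    simp only [map_smul, mul_smul_comm, smul_assoc, ← smul_sub, MulOpposite.op_smul, ← h]
    rw [← algebraMap_smul (PathAlgebra k Q)ᵐᵒᵖ t (lastArrowHom k y b), map_smul, algebraMap_smul]
  | ofPath a b p =>
    by_cases h : b = y
    · subst h
      rw [lastArrowHom_ofPath, vertex_mul]
      cases p with
      | nil => simp [lastArrow, trivialCoeff_vertex]
      | cons p f =>
        rw [lastArrow, Finsupp.linearCombination_single, trivialCoeff_cons, zero_smul, sub_zero,
          smul_eq_mul, ← MulOpposite.op_mul, vertex_mul, mul_ofPath_comp]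
        rfl
    · rw [lastArrowHom_of_ne _ _ h, mul_ofPath_of_ne _ _ _ h, trivialCoeff_of_target_ne _ _ h,
        map_zero, zero_smul, sub_zero, MulOpposite.op_zero]

/-- The coefficient of `e_y`, as a homomorphism on the opposite algebra. -/
def opTrivialCoeff (y : Q) : (PathAlgebra k Q)ᵐᵒᵖ →+* k :=
  (trivialCoeff k y).toRingHom.fromOpposite fun _ _ => mul_comm _ _

omit [Fintype Q] in
theorem isIdempotentElem_op_vertex (y : Q) : IsIdempotentElem (MulOpposite.op (vertex k y)) :=
  congrArg MulOpposite.op (isIdempotentElem_vertex k y)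

/-- The right ideal spanned by the nontrivial paths that end at `y`. -/
def rightRad (y : Q) : Ideal (PathAlgebra k Q)ᵐᵒᵖ :=
  Ideal.span {MulOpposite.op (vertex k y)} ⊓ RingHom.ker (opTrivialCoeff k y)

theorem projective_rightRad (y : Q) : Module.Projective (PathAlgebra k Q)ᵐᵒᵖ (rightRad k y) := by
  refine Ideal.projective_of_dualBasis _
    (fun f : Arrows Q => MulOpposite.op (vertex k y * ofPath k f.2.2.toPath)) (fun f => ?_)
    ((lastArrowHom k y).toAddMonoidHom.comp
      (MulOpposite.opAddEquiv (α := PathAlgebra k Q)).symm.toAddMonoidHom)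
    (fun b c hc => ?_) fun c hc => ?_
  · refine ⟨Ideal.mem_span_singleton'.2 ⟨MulOpposite.op (ofPath k f.2.2.toPath), rfl⟩, ?_⟩
    change trivialCoeff k y (_ * _) = 0
    rw [map_mul]
    exact mul_eq_zero_of_right _ (trivialCoeff_cons k y _ _)
  · have h : trivialCoeff k y c.unop = 0 := hc.2
    exact (lastArrowHom_mul k y c.unop b.unop).trans (by rw [h, zero_smul, add_zero]; rfl)
  · have h : trivialCoeff k y c.unop = 0 := hc.2
    refine (linearCombination_lastArrowHom k y c.unop).trans ?_
    rw [h, zero_smul, sub_zero, MulOpposite.op_mul]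
    exact Ideal.mul_eq_of_mem_span_singleton (isIdempotentElem_op_vertex k y) hc.1

end PathAlgebra

/-! ### Finiteness of the set of paths. -/

namespace Quiver

/-- Being joined by a nontrivial path is transitive, and acyclicity makes it irreflexive; on a
finite set this suffices. -/
theorem wellFounded_path (Q : Type v) [Quiver.{w} Q] [Finite Q] (hQ : IsAcyclicQuiver Q) :
    WellFounded fun a b : Q => ∃ p : Path a b, p.length ≠ 0 := by
  have : IsTrans Q fun a b : Q => ∃ p : Path a b, p.length ≠ 0 :=
    ⟨fun _ _ _ ⟨p, hp⟩ ⟨q, _⟩ => ⟨p.comp q, by rw [Path.length_comp]; omega⟩⟩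
  have : Std.Irrefl fun a b : Q => ∃ p : Path a b, p.length ≠ 0 :=
    ⟨fun a ⟨p, hp⟩ => hp (by rw [hQ a p]; rfl)⟩
  exact Finite.wellFounded_of_trans_of_irrefl _

theorem finite_path (Q : Type v) [Quiver.{w} Q] [Finite Q] [∀ a b : Q, Finite (a ⟶ b)]
    (hQ : IsAcyclicQuiver Q) (a b : Q) : Finite (Path a b) := by
  induction b using (wellFounded_path Q hQ).induction with
  | _ b ih =>
    have (c : Q) : Finite ((c ⟶ b) × Path a c) := by
      -- The induction hypothesis applies only to predecessors `c` of `b`; for any other `c` the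
      -- product is empty.
      by_cases h : Nonempty (c ⟶ b)
      · have := ih c ⟨h.some.toPath, Nat.succ_ne_zero _⟩
        infer_instance
      · have := not_nonempty_iff.1 h
        infer_instance
    -- A nontrivial path is determined by its last arrow and what precedes it. If one of two
    -- compared paths is trivial, then `b = a` and acyclicity makes both trivial.
    refine Finite.of_injective
      (fun p : Path a b => (Path.rec (motive := fun b _ => Option (Σ c, (c ⟶ b) × Path a c)) none
        (fun {c _} q f _ => some ⟨c, f, q⟩) p)) ?_
    intro p q h
    cases p with
    | nil => exact (hQ a q).symm
    | cons p f =>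
      cases q with
      | nil => exact hQ _ (p.cons f)
      | cons q g =>
        have h' := Option.some.inj h
        cases h'
        rfl

theorem finite_allPaths (Q : Type v) [Quiver.{w} Q] [Finite Q] [∀ a b : Q, Finite (a ⟶ b)]
    (hQ : IsAcyclicQuiver Q) : Finite (AllPaths Q) := by
  have := finite_path Q hQ
  exact inferInstanceAs (Finite (Σ (a : Q) (b : Q), Path a b))

end Quiver

/-! ### A criterion against projectivity, and the unit isomorphism of the tensor product. -/

/-- A section `s` of `a ↦ a • m` would give `b = s m` with `b • m = m` and `α * b = s (α • m) = 0`,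
forcing `m = 0`. -/
theorem Module.not_projective_of_annihilator {A M : Type*} [Ring A] [AddCommGroup M] [Module A M]
    (m : M) (hm : m ≠ 0) (hgen : ∀ n : M, ∃ a : A, a • m = n) (α : A) (hα : α • m = 0)
    (h : ∀ b : A, α * b = 0 → b • m = 0) : ¬ Module.Projective A M := by
  intro _
  obtain ⟨s, hs⟩ := Module.projective_lifting_property (LinearMap.toSpanSingleton A M m)
    LinearMap.id hgen
  refine hm ((LinearMap.congr_fun hs m).symm.trans (h (s m) ?_))
  rw [← smul_eq_mul, ← map_smul, hα, map_zero]

namespace BalancedTensor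

variable (R : Type*) [Ring R] (M : Type*) [AddCommGroup M] [Module Rᵐᵒᵖ M]

/-- The map `M ⊗_R R → M`, `m ⊗ r ↦ m r`. -/
def ridHom : BalancedTensor R M R →+ M :=
  QuotientAddGroup.lift (balancedRel R M R)
    (TensorProduct.liftAddHom
      ((smulAddHom Rᵐᵒᵖ M).comp (MulOpposite.opAddEquiv (α := R)).toAddMonoidHom).flip
      fun n m r => by rw [map_zsmul, map_zsmul]; rfl) (by
    rw [balancedRel, AddSubgroup.closure_le]
    rintro _ ⟨m, r, n, rfl⟩
    change _ = _
    rw [map_sub, sub_eq_zero]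
    change MulOpposite.op n • MulOpposite.op r • m = MulOpposite.op (r * n) • m
    rw [smul_smul, MulOpposite.op_mul])

theorem ridHom_tmul (m : M) (r : R) : ridHom R M (tmul R m r) = MulOpposite.op r • m := rfl

/-- The inverse is `ridHom`. This is needed because the first tensor power is by definition `M ⊗_B
B` rather than `M`. -/
theorem tmul_one_bijective : Function.Bijective fun m : M => tmul R m (1 : R) := by
  refine ⟨fun m m' h => ?_, fun t => ⟨ridHom R M t, ?_⟩⟩
  · simpa [ridHom_tmul] using congrArg (ridHom R M) h
  · let φ : M →+ BalancedTensor R M R :=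
      AddMonoidHom.mk' (fun m => tmul R m (1 : R)) fun m m' => add_tmul m m' _
    refine DFunLike.congr_fun (f := φ.comp (ridHom R M)) (g := AddMonoidHom.id _)
      (hom_ext fun m r => ?_) t
    change tmul R (MulOpposite.op r • m) (1 : R) = tmul R m r
    rw [smul_tmul, smul_eq_mul, mul_one]

end BalancedTensor

/-! ### Coefficients of arrows, and resolutions of the simple modules. -/

namespace PathAlgebra

variable (k : Type u) [Field k] {Q : Type v} [Quiver.{w} Q]

/-- The coefficient of a path. -/
def coeff {a b : Q} (p : Quiver.Path a b) : PathAlgebra k Q →ₗ[k] k :=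
  Finsupp.lapply (⟨a, b, p⟩ : AllPaths Q)

theorem coeff_self {a b : Q} (p : Quiver.Path a b) : coeff k p (ofPath k p) = 1 :=
  Finsupp.single_eq_same

theorem coeff_of_length_ne {a b c d : Q} (p : Quiver.Path a b) (q : Quiver.Path c d)
    (h : q.length ≠ p.length) : coeff k p (ofPath k q) = 0 :=
  Finsupp.single_eq_of_ne fun e => h (congrArg (fun r : AllPaths Q => r.2.2.length) e.symm)

variable [Fintype Q]

/-- For a path `p`, the product `f p` is zero or has length one more than `p`, so it can equal `f`
only when `p = e_x`. -/
theorem coeff_arrow_mul {x a : Q} (f : x ⟶ a) (b : PathAlgebra k Q) :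
    coeff k f.toPath (ofPath k f.toPath * b) = trivialCoeff k x b := by
  induction b using induction with
  | zero => simp
  | add b c hb hc => rw [mul_add, map_add, map_add, hb, hc]
  | smul t b hb => rw [mul_smul_comm, map_smul, map_smul, hb]
  | ofPath c d p =>
    by_cases h : d = x
    · subst h
      rw [mul_ofPath_comp]
      cases p with
      | nil => rw [Quiver.Path.nil_comp, coeff_self, trivialCoeff_vertex]
      | cons p g =>
        rw [trivialCoeff_cons, coeff_of_length_ne]
        simp
    · rw [mul_ofPath_of_ne _ _ _ h, map_zero, trivialCoeff_of_target_ne _ _ h]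

theorem coeff_mul_arrow {y a : Q} (f : a ⟶ y) (b : PathAlgebra k Q) :
    coeff k f.toPath (b * ofPath k f.toPath) = trivialCoeff k y b := by
  induction b using induction with
  | zero => simp
  | add b c hb hc => rw [add_mul, map_add, map_add, hb, hc]
  | smul t b hb => rw [smul_mul_assoc, map_smul, map_smul, hb]
  | ofPath c d p =>
    by_cases h : y = c
    · subst h
      rw [mul_ofPath_comp]
      cases p with
      | nil => rw [Quiver.Path.comp_nil, coeff_self, trivialCoeff_vertex]
      | cons p g =>
        rw [trivialCoeff_cons, coeff_of_length_ne]
        simp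
    · rw [mul_ofPath_of_ne _ _ _ h, map_zero, trivialCoeff_of_source_ne _ _ (Ne.symm h)]

/-- The space `e_y B e_x` is spanned by the paths from `x` to `y`. -/
theorem vertex_mul_mul_vertex {x y : Q} (h : IsEmpty (Quiver.Path x y)) (b : PathAlgebra k Q) :
    vertex k y * (b * vertex k x) = 0 := by
  induction b using induction with
  | zero => simp
  | add b c hb hc => rw [add_mul, mul_add, hb, hc, add_zero]
  | smul t b hb => rw [smul_mul_assoc, mul_smul_comm, hb, smul_zero]
  | ofPath c d p =>
    by_cases hx : x = c
    · subst hx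
      by_cases hy : d = y
      · subst hy
        exact h.elim p
      · rw [mul_vertex, mul_ofPath_of_ne _ _ _ hy]
    · rw [mul_ofPath_of_ne _ _ _ hx, mul_zero]

theorem moduleFinite [∀ a b : Q, Finite (a ⟶ b)] (hQ : Quiver.IsAcyclicQuiver Q) :
    Module.Finite k (PathAlgebra k Q) := by
  have := Quiver.finite_allPaths Q hQ
  exact inferInstanceAs (Module.Finite k (AllPaths Q →₀ k))

/-- The augmentation `kQ e_x → S(x)`. -/
def leftAug (x : Q) : Ideal.span {vertex k x} →ₗ[PathAlgebra k Q] LeftSimple k x where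
  toFun b := (trivialCoeff k x (b : PathAlgebra k Q) : k)
  map_add' _ _ := map_add (trivialCoeff k x) _ _
  map_smul' _ _ := map_mul (trivialCoeff k x) _ _

/-- The inclusion of the radical of `kQ e_x`. -/
def leftIncl (x : Q) : leftRad k x →ₗ[PathAlgebra k Q] Ideal.span {vertex k x} :=
  Submodule.inclusion inf_le_left

theorem leftIncl_injective (x : Q) : Function.Injective (leftIncl k x) :=
  Submodule.inclusion_injective _

theorem leftAug_surjective (x : Q) : Function.Surjective (leftAug k x) := fun (c : k) =>
  ⟨⟨c • vertex k x, Submodule.smul_of_tower_mem _ c (Ideal.mem_span_singleton_self _)⟩,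
    (map_smul (trivialCoeff k x) c _).trans (by
      rw [trivialCoeff_vertex]
      exact mul_one c)⟩

theorem leftIncl_exact_leftAug (x : Q) : Function.Exact (leftIncl k x) (leftAug k x) := fun b =>
  ⟨fun h => ⟨⟨b, b.2, h⟩, rfl⟩, by rintro ⟨c, rfl⟩; exact c.2.2⟩

/-- The augmentation `e_y kQ → T(y)`. -/
def rightAug (y : Q) :
    Ideal.span {MulOpposite.op (vertex k y)} →ₗ[(PathAlgebra k Q)ᵐᵒᵖ] RightSimple k y where
  toFun b := (opTrivialCoeff k y (b : (PathAlgebra k Q)ᵐᵒᵖ) : k)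
  map_add' _ _ := map_add (opTrivialCoeff k y) _ _
  map_smul' _ _ := map_mul (opTrivialCoeff k y) _ _

/-- The inclusion of the radical of `e_y kQ`. -/
def rightIncl (y : Q) :
    rightRad k y →ₗ[(PathAlgebra k Q)ᵐᵒᵖ] Ideal.span {MulOpposite.op (vertex k y)} :=
  Submodule.inclusion inf_le_left

theorem rightIncl_injective (y : Q) : Function.Injective (rightIncl k y) :=
  Submodule.inclusion_injective _

theorem rightAug_surjective (y : Q) : Function.Surjective (rightAug k y) := fun (c : k) =>
  ⟨⟨c • MulOpposite.op (vertex k y),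
      Submodule.smul_of_tower_mem _ c (Ideal.mem_span_singleton_self _)⟩,
    (map_smul (trivialCoeff k y) c _).trans (by
      rw [MulOpposite.unop_op, trivialCoeff_vertex]
      exact mul_one c)⟩

theorem rightIncl_exact_rightAug (y : Q) : Function.Exact (rightIncl k y) (rightAug k y) := fun b =>
  ⟨fun h => ⟨⟨b, b.2, h⟩, rfl⟩, by rintro ⟨c, rfl⟩; exact c.2.2⟩

end PathAlgebra

/-! ### The bimodule `S(x) ⊗ T(y)` and its trivial extension. -/

section SimpleTensor

open PathAlgebra

variable (k : Type u) [Field k] {Q : Type v} [Quiver.{w} Q] [Fintype Q] (x y : Q)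

namespace SimpleTensor

instance : Module.Finite k (SimpleTensor k x y) :=
  have : Module.Finite k (LeftSimple k x) := inferInstanceAs (Module.Finite k k)
  have : Module.Finite k (RightSimple k y) := inferInstanceAs (Module.Finite k k)
  inferInstance

theorem smul_eq (b : PathAlgebra k Q) (m : SimpleTensor k x y) :
    b • m = trivialCoeff k x b • m := by
  induction m using TensorProduct.induction_on with
  | zero => rw [smul_zero, smul_zero]
  | add m n hm hn => rw [smul_add, smul_add, hm, hn]
  | tmul s t => rfl

theorem op_smul_eq (b : (PathAlgebra k Q)ᵐᵒᵖ) (m : SimpleTensor k x y) :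
    b • m = trivialCoeff k y b.unop • m := by
  induction m using TensorProduct.induction_on with
  | zero => rw [smul_zero, smul_zero]
  | add m n hm hn => rw [smul_add, smul_add, hm, hn]
  | tmul s t =>
    rw [SimpleTensor.op_smul_tmul, RightSimple.smul_def, TensorProduct.tmul_smul]

/-- The generator `1` of `S(x)`. -/
def leftGen : LeftSimple k x := (1 : k)

/-- The generator `1` of `T(y)`. -/
def rightGen : RightSimple k y := (1 : k)

/-- The generator `1 ⊗ 1`. -/
def gen : SimpleTensor k x y := leftGen k x ⊗ₜ rightGen k y

/-- `S(x) ⊗ T(y)` is one-dimensional. -/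
def equivField : SimpleTensor k x y ≃ₗ[k] k := TensorProduct.lid k k

omit [Quiver.{w} Q] [Fintype Q] in
theorem equivField_gen : equivField k x y (gen k x y) = 1 :=
  (TensorProduct.lid_tmul (R := k) (1 : k) (1 : k)).trans (one_smul _ _)

omit [Quiver.{w} Q] [Fintype Q] in
theorem smul_gen_surjective (m : SimpleTensor k x y) : ∃ c : k, c • gen k x y = m :=
  ⟨equivField k x y m, (equivField k x y).injective (by
    rw [map_smul, equivField_gen, smul_eq_mul, mul_one])⟩

omit [Quiver.{w} Q] [Fintype Q] in
theorem gen_ne_zero : gen k x y ≠ 0 := fun h => by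
  simpa [h] using equivField_gen k x y

/-- The test element is an arrow `f` leaving `x`: it kills the generator, while `f b = 0` forces the
coefficient of `e_x` in `b`, hence the action of `b`, to vanish. -/
theorem not_projective_left (hx : ∃ a : Q, Nonempty (x ⟶ a)) :
    ¬ Module.Projective (PathAlgebra k Q) (SimpleTensor k x y) := by
  obtain ⟨a, ⟨f⟩⟩ := hx
  refine Module.not_projective_of_annihilator (gen k x y) (gen_ne_zero k x y) (fun m => ?_)
    (ofPath k f.toPath) ?_ fun b hb => ?_
  · obtain ⟨c, rfl⟩ := smul_gen_surjective k x y m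
    exact ⟨algebraMap k _ c, by rw [smul_eq, AlgHom.commutes]; rfl⟩
  · rw [smul_eq]
    refine (congrArg (· • gen k x y) (trivialCoeff_cons k x _ f)).trans (zero_smul _ _)
  · rw [smul_eq, ← coeff_arrow_mul k f, hb, map_zero, zero_smul]

theorem not_projective_right (hy : ∃ a : Q, Nonempty (a ⟶ y)) :
    ¬ Module.Projective (PathAlgebra k Q)ᵐᵒᵖ (SimpleTensor k x y) := by
  obtain ⟨a, ⟨f⟩⟩ := hy
  refine Module.not_projective_of_annihilator (gen k x y) (gen_ne_zero k x y) (fun m => ?_)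
    (MulOpposite.op (ofPath k f.toPath)) ?_ fun b hb => ?_
  · obtain ⟨c, rfl⟩ := smul_gen_surjective k x y m
    exact ⟨MulOpposite.op (algebraMap k _ c), by
      rw [op_smul_eq, MulOpposite.unop_op, AlgHom.commutes]; rfl⟩
  · rw [op_smul_eq]
    refine (congrArg (· • gen k x y) (trivialCoeff_cons k y _ f)).trans (zero_smul _ _)
  -- Multiplying by `f` on the left in the opposite algebra is multiplying on the right in `kQ`,
  -- whence `coeff_mul_arrow`.
  · have hb' : b.unop * ofPath k f.toPath = 0 := congrArg MulOpposite.unop hb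
    rw [op_smul_eq, ← coeff_mul_arrow k f, hb', map_zero, zero_smul]

variable (Q) in
/-- The inclusion of `B` in the trivial extension `A = B ⋉ M`. -/
abbrev incl (x y : Q) : PathAlgebra k Q →ₐ[k]
    TrivSqZeroExt (PathAlgebra k Q) (SimpleTensor k x y) :=
  TrivSqZeroExt.inlAlgHom k (PathAlgebra k Q) (SimpleTensor k x y)

/-- The quotient `A / B` of the trivial extension `A = B ⋉ M` is `M`. -/
def toQuot : SimpleTensor k x y →+ ExtensionQuotient (incl k Q x y) :=
  (ExtensionQuotient.mk (incl k Q x y)).toAddMonoidHom.comp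
    (AddMonoidHom.mk' TrivSqZeroExt.inr (TrivSqZeroExt.inr_add _))

theorem toQuot_apply (m : SimpleTensor k x y) :
    toQuot k x y m = ExtensionQuotient.mk (incl k Q x y) (TrivSqZeroExt.inr m) := rfl

theorem toQuot_smul (b : PathAlgebra k Q) (m : SimpleTensor k x y) :
    toQuot k x y (b • m) = b • toQuot k x y m := by
  rw [toQuot_apply, toQuot_apply, ExtensionQuotient.smul_mk]
  exact congrArg _ (TrivSqZeroExt.inl_mul_inr b m).symm

theorem toQuot_op_smul (b : (PathAlgebra k Q)ᵐᵒᵖ) (m : SimpleTensor k x y) :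
    toQuot k x y (b • m) = b • toQuot k x y m := by
  rw [toQuot_apply, toQuot_apply, ExtensionQuotient.op_smul_mk]
  exact congrArg _ (TrivSqZeroExt.inr_mul_inl b.unop m).symm

theorem toQuot_bijective : Function.Bijective (toQuot k x y) := by
  refine ⟨(injective_iff_map_eq_zero _).2 fun m hm => ?_, fun t => ?_⟩
  · obtain ⟨b, hb⟩ := (Submodule.Quotient.mk_eq_zero _).1 hm
    have h : (TrivSqZeroExt.inl b : TrivSqZeroExt (PathAlgebra k Q) (SimpleTensor k x y)) =
      TrivSqZeroExt.inr m := hb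
    simpa using (congrArg TrivSqZeroExt.snd h).symm
  · obtain ⟨a, rfl⟩ := ExtensionQuotient.mk_surjective _ t
    refine ⟨a.snd, ?_⟩
    rw [toQuot_apply, ← sub_eq_zero, ← map_sub]
    -- The difference `inr a.snd - a` is `inl (-a.fst)`, which lies in `B`.
    refine (Submodule.Quotient.mk_eq_zero _).2 ⟨-a.fst, ?_⟩
    change TrivSqZeroExt.inl (-a.fst) = _
    ext <;> simp

theorem vertex_op_smul_quot (m : ExtensionQuotient (incl k Q x y)) :
    MulOpposite.op (vertex k y) • m = m := by
  obtain ⟨m, rfl⟩ := (toQuot_bijective k x y).2 m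
  rw [← toQuot_op_smul, op_smul_eq, MulOpposite.unop_op, trivialCoeff_vertex, one_smul]

variable {x y} in
theorem vertex_smul_quot (hxy : x ≠ y) (m : ExtensionQuotient (incl k Q x y)) :
    vertex k y • m = 0 := by
  obtain ⟨m, rfl⟩ := (toQuot_bijective k x y).2 m
  rw [← toQuot_smul, smul_eq, trivialCoeff_vertex_of_ne k hxy.symm, zero_smul, map_zero]

variable {x y} in
-- The left action on a positive tensor power is on the leftmost factor `A / B`, where `e_y` is
-- zero.
theorem vertex_smul_tensorPow (hxy : x ≠ y) (j : ℕ)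
    (t : ((ExtensionQuotient.bimodule (incl k Q x y)).tensorPow (j + 1)).carrier) :
    vertex k y • t = 0 :=
  DFunLike.congr_fun
    (f := BalancedTensor.leftEnd (PathAlgebra k Q) (ExtensionQuotient (incl k Q x y))
      ((ExtensionQuotient.bimodule (incl k Q x y)).tensorPow j).carrier (PathAlgebra k Q)
      (vertex k y))
    (g := 0)
    (BalancedTensor.hom_ext fun m n => by
      change BalancedTensor.tmul (PathAlgebra k Q) (vertex k y • m) n = 0
      rw [vertex_smul_quot k hxy, BalancedTensor.zero_tmul]) t

variable {x y} in
theorem subsingleton_tensorPow (hxy : x ≠ y) (j : ℕ) :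
    Subsingleton ((ExtensionQuotient.bimodule (incl k Q x y)).tensorPow (j + 2)).carrier :=
  BalancedTensor.subsingleton_of_idempotent (vertex k y) (vertex_op_smul_quot k x y)
    (vertex_smul_tensorPow k hxy j)

/-- The isomorphism `S(x) → (A / B) ⊗_B B` of left modules. -/
def toTensorPowOne : LeftSimple k x →ₗ[PathAlgebra k Q]
    ((ExtensionQuotient.bimodule (incl k Q x y)).tensorPow 1).carrier where
  toFun s := (BalancedTensor.tmul (PathAlgebra k Q) (toQuot k x y (s ⊗ₜ rightGen k y))
    (1 : PathAlgebra k Q) :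
      BalancedTensor (PathAlgebra k Q) (ExtensionQuotient (incl k Q x y)) (PathAlgebra k Q))
  map_add' s t := by
    rw [TensorProduct.add_tmul, map_add]
    exact BalancedTensor.add_tmul (R := PathAlgebra k Q) (N := PathAlgebra k Q) _ _ _
  map_smul' b s := by
    rw [← SimpleTensor.smul_tmul_left, toQuot_smul]
    rfl

theorem toTensorPowOne_bijective : Function.Bijective (toTensorPowOne k x y) :=
  (BalancedTensor.tmul_one_bijective (PathAlgebra k Q)
    (ExtensionQuotient (incl k Q x y))).comp
    ((toQuot_bijective k x y).comp (TensorProduct.rid k k).symm.bijective)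

/-- For `j = 1` the resolution of `S(x)` is transported along `toTensorPowOne`, and `e_y` kills its
syzygy because no path leads from `x` to `y`. For `j ≥ 2` the tensor power is already zero. -/
theorem isZero_torGroup (hxy : x ≠ y) (hpath : IsEmpty (Quiver.Path x y)) (i j : ℕ) (hi : 1 ≤ i)
    (hj : 1 ≤ j) :
    Limits.IsZero (torGroup (PathAlgebra k Q) (ExtensionQuotient (incl k Q x y))
      ((ExtensionQuotient.bimodule (incl k Q x y)).tensorPow j).carrier i) := by
  match j, hj with
  | 1, _ =>
    have := projective_leftRad k x
    have := Ideal.projective_span_singleton (isIdempotentElem_vertex k x)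
    refine isZero_torGroup_of_idempotent _ (leftIncl k x) (toTensorPowOne k x y ∘ₗ leftAug k x)
      ?_ (leftIncl_injective k x)
      ((toTensorPowOne_bijective k x y).2.comp (leftAug_surjective k x)) (vertex k y)
      (vertex_op_smul_quot k x y) (fun b => Subtype.ext ?_) i hi
    · intro b
      rw [← leftIncl_exact_leftAug k x b, LinearMap.comp_apply,
        map_eq_zero_iff _ (toTensorPowOne_bijective k x y).1]
    · obtain ⟨b, hb, -⟩ := b
      obtain ⟨a, rfl⟩ := Ideal.mem_span_singleton'.1 hb
      exact vertex_mul_mul_vertex k hpath a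
  | j + 2, _ =>
    have := subsingleton_tensorPow k hxy j
    exact isZero_torGroup_of_subsingleton _ i hi

/-- The isomorphism of the external tensor product `S(x) ⊗_k T(y)` with `A / B`. -/
def toEnveloping : ExternalTensor k (PathAlgebra k Q) (PathAlgebra k Q)ᵐᵒᵖ
      (LeftSimple k x) (RightSimple k y) →ₗ[PathAlgebra k Q ⊗[k] (PathAlgebra k Q)ᵐᵒᵖ]
    (ExtensionQuotient.bimodule (incl k Q x y)).envelopingModule :=
  ExternalTensor.linearMapOfTmul (toQuot k x y) fun b c s t => by
    change toQuot k x y (b • c • (s ⊗ₜ[k] t : SimpleTensor k x y)) = b • c • toQuot k x y (s ⊗ₜ t)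
    rw [toQuot_smul, toQuot_op_smul]

/-- Tensoring a projective `L` with `0 → rad(e_y B) → e_y B → T(y) → 0` gives a projective
resolution of length one; the strict bound 2 means dimension at most 1. It is applied to `B e_x` and
to its radical. -/
theorem hasProjectiveDimensionLT_externalTensor_rightSimple (L : Type max u v w) [AddCommGroup L]
    [Module k L] [Module (PathAlgebra k Q) L] [IsScalarTower k (PathAlgebra k Q) L]
    [Module.Projective (PathAlgebra k Q) L] :
    HasProjectiveDimensionLT (ModuleCat.of (PathAlgebra k Q ⊗[k] (PathAlgebra k Q)ᵐᵒᵖ)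
      (ExternalTensor k (PathAlgebra k Q) (PathAlgebra k Q)ᵐᵒᵖ L (RightSimple k y))) 2 := by
  have := projective_rightRad k y
  have := Ideal.projective_span_singleton (isIdempotentElem_op_vertex k y)
  have := ExternalTensor.projective k (PathAlgebra k Q) (PathAlgebra k Q)ᵐᵒᵖ (M := L)
    (N := rightRad k y)
  have := ExternalTensor.projective k (PathAlgebra k Q) (PathAlgebra k Q)ᵐᵒᵖ (M := L)
    (N := Ideal.span {MulOpposite.op (vertex k y)})
  have := hasProjectiveDimensionLT_one_of_projective
    (R := PathAlgebra k Q ⊗[k] (PathAlgebra k Q)ᵐᵒᵖ)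
    (X := ExternalTensor k (PathAlgebra k Q) (PathAlgebra k Q)ᵐᵒᵖ L
      (Ideal.span {MulOpposite.op (vertex k y)}))
  exact hasProjectiveDimensionLT_of_exact _ _
    (ExternalTensor.id_map_exact k (PathAlgebra k Q) (PathAlgebra k Q)ᵐᵒᵖ (M := L) _ _
      (rightIncl_exact_rightAug k y))
    (ExternalTensor.id_map_injective k _ _ _ (rightIncl_injective k y))
    (ExternalTensor.id_map_surjective k _ _ _ (rightAug_surjective k y)) 1
    hasProjectiveDimensionLT_one_of_projective
    (hasProjectiveDimensionLT_of_ge _ 1 2 (by omega))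

/-- Tensoring `0 → rad(B e_x) → B e_x → S(x) → 0` with `T(y)` presents `A / B` as a quotient of two
bimodules of dimension at most 1, which raises the bound by one. -/
theorem hasProjectiveDimensionLE_envelopingModule :
    HasProjectiveDimensionLE
      (ExtensionQuotient.bimodule (incl k Q x y)).envelopingModule 2 := by
  have := projective_leftRad k x
  have := Ideal.projective_span_singleton (isIdempotentElem_vertex k x)
  have := hasProjectiveDimensionLT_externalTensor_rightSimple k y (leftRad k x)
  have := hasProjectiveDimensionLT_externalTensor_rightSimple k y
    (Ideal.span {vertex k x} : Ideal (PathAlgebra k Q))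
  refine hasProjectiveDimensionLT_of_exact
    (ExternalTensor.map k (PathAlgebra k Q) (PathAlgebra k Q)ᵐᵒᵖ (leftIncl k x)
      (LinearMap.id : RightSimple k y →ₗ[(PathAlgebra k Q)ᵐᵒᵖ] RightSimple k y))
    (toEnveloping k x y ∘ₗ ExternalTensor.map k (PathAlgebra k Q) (PathAlgebra k Q)ᵐᵒᵖ
      (leftAug k x) LinearMap.id) ?_
    (ExternalTensor.map_id_injective k _ _ _ (leftIncl_injective k x))
    ((toQuot_bijective k x y).2.comp
      (ExternalTensor.map_id_surjective k _ _ _ (leftAug_surjective k x))) 2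
    inferInstance (hasProjectiveDimensionLT_of_ge _ 2 3 (by omega))
  intro b
  rw [← ExternalTensor.map_id_exact k _ _ _ _ (leftIncl_exact_leftAug k x) b,
    LinearMap.comp_apply]
  exact map_eq_zero_iff (toQuot k x y) (toQuot_bijective k x y).1

end SimpleTensor

end SimpleTensor

end

/-! ### The theorem. -/

theorem mainTheorem11 (k : Type u) [Field k] (Q : Type v) [Quiver.{w} Q] [Fintype Q]
    [∀ a b : Q, Finite (a ⟶ b)] (hQ : Quiver.IsAcyclicQuiver Q) (x y : Q) (hxy : x ≠ y)
    (hx : ∃ a : Q, Nonempty (x ⟶ a)) (hy : ∃ a : Q, Nonempty (a ⟶ y))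
    (hpath : IsEmpty (Quiver.Path x y)) :
    IsBoundedExtension
        (TrivSqZeroExt.inlAlgHom k (PathAlgebra k Q) (SimpleTensor k x y)) ∧
      ¬ Module.Projective (PathAlgebra k Q) (SimpleTensor k x y) ∧
      ¬ Module.Projective (PathAlgebra k Q)ᵐᵒᵖ (SimpleTensor k x y) := by
  have := PathAlgebra.moduleFinite k hQ
  exact ⟨{
    finite_sub := this
    finite_ext := inferInstanceAs (Module.Finite k (PathAlgebra k Q × SimpleTensor k x y))
    injective := TrivSqZeroExt.inl_injective
    nilpotent := ⟨2, one_le_two, SimpleTensor.subsingleton_tensorPow k hxy 0⟩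
    finite_projDim := ⟨2, SimpleTensor.hasProjectiveDimensionLE_envelopingModule k x y⟩
    tor_eq_zero := SimpleTensor.isZero_torGroup k x y hxy hpath },
    SimpleTensor.not_projective_left k x y hx, SimpleTensor.not_projective_right k x y hy⟩
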